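/- For positive integers $a,b,c$ let $$T(a,b,c)=\sum_{n=1}^{\infty}\sum_{m=1}^{\infty}\frac{1}{n^{a}m^{b}(n+m)^{c}}$$ be the Tornheim double series. Let $B_k(q)$ be the $k$-th Bernoulli polynomial, and for $k\ge 1$ and $0<q<1$ let $A_k(q)=k\,\zeta'(1-k,q)$, where $\zeta(z,q)$ is the (analytically continued) Hurwitz zeta function and $'$ is the derivative in $z$. Define $$\begin{aligned} R_1(a,b,c)&=\int_0^1 B_a(q)B_b(q)B_c(q)\,dq, & R_2(a,b,c)&=\frac1{\pi}\int_0^1 B_a(q)B_b(q)A_c(q)\,dq,\\ R_3(a,b,c)&=\frac1{\pi^2}\int_0^1 A_a(q)A_b(q)B_c(q)\,dq, & R_4(a,b,c)&=\frac1{\pi^2}\int_0^1 A_a(q)A_b(1-q)B_c(q)\,dq,\\ R_5(a,b,c)&=\frac1{\pi^3}\int_0^1 A_a(q)A_b(q)A_c(q)\,dq, & R_6(a,b,c)&=\frac1{\pi^3}\int_0^1 A_a(q)A_b(q)A_c(1-q)\,dq, \end{aligned}$$ and let $p(n)=(-1)^{n/2}$ for $n$ even, $p(n)=(-1)^{(n+1)/2}$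 for $n$ odd. **Theorem.** Let $n_1,n_2,n_3$ be positive integers and $\alpha=n_1+n_2+n_3$. The double series $T(n_1,n_2,n_3)$ and the integrals $R_j(n_1,n_2,n_3)$, $1\le j\le 6$, converge absolutely, $T(n_1,n_2,n_3)=T(n_2,n_1,n_3)$, and $$T(n_1,n_2,n_3)=p(\alpha)\,\frac{(2\pi)^{\alpha}}{2\,n_1!\,n_2!\,n_3!}\,T_R(n_1,n_2,n_3),$$ where: 1. if $n_1,n_2,n_3$ are even, $T_R(n_1,n_2,n_3)=-\tfrac12R_1(n_1,n_2,n_3)+R_3(n_1,n_2,n_3)-R_4(n_1,n_2,n_3)$; 2. if $n_1,n_2$ are even and $n_3$ is odd, $T_R(n_1,n_2,n_3)=-R_2(n_1,n_2,n_3)+R_5(n_1,n_2,n_3)+R_6(n_1,n_2,n_3)-R_6(n_3,n_1,n_2)-R_6(n_3,n_2,n_1)$; 3. if $n_1$ is even, $n_2$ is odd and $n_3$ is even, $T_R(n_1,n_2,n_3)=-R_2(n_3,n_1,n_2)-R_2(n_3,n_2,n_1)$; 4. if $n_1$ is even and $n_2,n_3$ are odd, $T_R(n_1,n_2,n_3)=R_3(n_3,n_1,n_2)+R_3(n_3,n_2,n_1)+R_4(n_1,n_3,n_2)+R_4(n_2,n_3,n_1)$;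 5. if $n_1,n_2$ are odd and $n_3$ is even, $T_R(n_1,n_2,n_3)=-\tfrac12R_1(n_1,n_2,n_3)+R_3(n_1,n_2,n_3)+R_4(n_1,n_2,n_3)$; 6. if $n_1,n_2,n_3$ are odd, $T_R(n_1,n_2,n_3)=-R_2(n_1,n_2,n_3)+R_5(n_1,n_2,n_3)+R_6(n_1,n_2,n_3)+R_6(n_3,n_1,n_2)+R_6(n_3,n_2,n_1)$. (The two remaining parity classes, $n_1$ odd and $n_2$ even, reduce to cases 3 and 4 by the symmetry.) -/

import Mathlib

open MeasureTheory

namespace Tornheim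

noncomputable section

/-- The general term `1 / (n^a m^b (n+m)^c)` of the Tornheim double series. -/
def term (a b c : ℂ) (n m : ℕ+) : ℂ :=
  1 / ((n : ℂ) ^ a * (m : ℂ) ^ b * ((n : ℂ) + (m : ℂ)) ^ c)

/-- The Tornheim double series `T(a,b,c) = ∑_{n ≥ 1} ∑_{m ≥ 1} 1 / (n^a m^b (n+m)^c)`. -/
def T (a b c : ℂ) : ℂ := ∑' n : ℕ+, ∑' m : ℕ+, term a b c n m

/-- The Bernoulli polynomial `B_k(q)` at a real point. -/
def B (k : ℕ) (q : ℝ) : ℂ := (bernoulliFun k q : ℂ)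

/-- The Bernoulli function `A_k(q) = k ζ'(1 - k, q)`; the derivative is taken in the first
argument of the Hurwitz zeta function. For `0 < q ≤ 1`, Mathlib's
`hurwitzZeta (q : UnitAddCircle)` is the analytic continuation of
`s ↦ ∑_{n ≥ 0} 1 / (n + q)^s`. Only `0 < q < 1` matters below. -/
def A (k : ℕ) (q : ℝ) : ℂ :=
  (k : ℂ) * deriv (fun s : ℂ => HurwitzZeta.hurwitzZeta (q : UnitAddCircle) s) (1 - (k : ℂ))

def R₁ (a b c : ℕ) : ℂ := ∫ q in (0 : ℝ)..1, B a q * B b q * B c q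

def R₂ (a b c : ℕ) : ℂ := 1 / (Real.pi : ℂ) * ∫ q in (0 : ℝ)..1, B a q * B b q * A c q

def R₃ (a b c : ℕ) : ℂ := 1 / (Real.pi : ℂ) ^ 2 * ∫ q in (0 : ℝ)..1, A a q * A b q * B c q

def R₄ (a b c : ℕ) : ℂ := 1 / (Real.pi : ℂ) ^ 2 * ∫ q in (0 : ℝ)..1, A a q * A b (1 - q) * B c q

def R₅ (a b c : ℕ) : ℂ := 1 / (Real.pi : ℂ) ^ 3 * ∫ q in (0 : ℝ)..1, A a q * A b q * A c q

def R₆ (a b c : ℕ) : ℂ := 1 / (Real.pi : ℂ) ^ 3 * ∫ q in (0 : ℝ)..1, A a q * A b q * A c (1 - q)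

/-- The sign `p(n)`: `(-1)^(n/2)` for `n` even and `(-1)^((n+1)/2)` for `n` odd. -/
def p (n : ℕ) : ℂ := if Even n then (-1) ^ (n / 2) else (-1) ^ ((n + 1) / 2)

/-- The factor `p(α) (2π)^α / (2 n₁! n₂! n₃!)` with `α = n₁ + n₂ + n₃`. -/
def prefactor (n₁ n₂ n₃ : ℕ) : ℂ :=
  p (n₁ + n₂ + n₃) * ((2 * (Real.pi : ℂ)) ^ (n₁ + n₂ + n₃) /
    (2 * (n₁.factorial : ℂ) * (n₂.factorial : ℂ) * (n₃.factorial : ℂ)))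

end

end Tornheim

/-!
Put `F_k(q) = ∑_{n ≥ 1} e^{2πinq} / n^k`. Orthogonality of the exponentials gives
`T(a,b,c) = ∫₀¹ F_a(q) F_b(q) F_c(1 - q) dq` and `0 = ∫₀¹ F_a(q) F_b(q) F_c(q) dq`. Moreover
`F_k(q) = -(2πi)^k / (2 k!) (B_k(q) + (i/π) C_k(q))` with `C_k(q) = A_k(q) - (-1)^k A_k(1 - q)`.
Expanding both integrals and discarding the products that are odd under `q ↦ 1 - q` leaves two
relations, and eliminating one product between them expresses `T` by integrals of products of the
`B_k` and `C_k`. Inserting the definition of `C_k` and using the reflection once more gives the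
integrals `R_j`.

For `k ≥ 2` the formula for `F_k` follows from the functional equation of the Hurwitz zeta function,
differentiated at `s = k` (`A_sub_neg_one_pow_mul_A`): in the combination `C_k` the factor
`e^{-πis/2} - (-1)^k e^{πis/2}` vanishes at `s = k`, so no logarithmic series survives.
For `k = 1` it follows from Lerch's formula (`deriv_hurwitzZeta_zero`) and the reflection formula of
the Gamma function, compared with `F_1(q) = -log (1 - e^{2πiq})` (`boundaryPolylog_one`). Lerch's
formula itself comes from continuing `ζ(s, q) - ζ(s)` to `Re s > -1/2` by linear interpolation
between consecutive terms, after which the derivative at `0` is the limit defining `log Γ(q)`.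

As `F_1` is only conditionally convergent, the two integral identities are first proved on circles
of radius `r < 1`, and `r → 1` is justified by dominated convergence. All functions involved are
`O((q (1 - q))^(-1/4))` on `(0, 1)` (`MildAtEndpoints`, `exists_norm_polylog_polar_le`), which makes
every product of three of them integrable.
-/

/-! ### Lerch's formula for the derivative of the Hurwitz zeta function at `0` -/

namespace Tornheim

open Complex Filter Topology Set

/-- Linear interpolation is accurate to second order. -/
lemma norm_sub_linear_interpolation_le {f f' f'' : ℝ → ℂ} {M : ℝ}
    (hf : ∀ t ∈ Icc (0 : ℝ) 1, HasDerivAt f (f' t) t)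
    (hf' : ∀ t ∈ Icc (0 : ℝ) 1, HasDerivAt f' (f'' t) t)
    (hM : ∀ t ∈ Icc (0 : ℝ) 1, ‖f'' t‖ ≤ M) {q : ℝ} (hq : q ∈ Icc (0 : ℝ) 1) :
    ‖f q - (1 - q) * f 0 - q * f 1‖ ≤ 2 * M := by
  have h0 : (0 : ℝ) ∈ Icc (0 : ℝ) 1 := by simp
  have h1 : (1 : ℝ) ∈ Icc (0 : ℝ) 1 := by simp
  have hM0 : 0 ≤ M := (norm_nonneg _).trans (hM 0 h0)
  have key1 : ∀ t ∈ Icc (0 : ℝ) 1, ‖f' t - f' 0‖ ≤ M := fun t ht => by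
    have := Convex.norm_image_sub_le_of_norm_hasDerivWithin_le
      (fun x hx => (hf' x hx).hasDerivWithinAt) hM (convex_Icc 0 1) h0 ht
    refine this.trans ?_
    rw [sub_zero, Real.norm_of_nonneg ht.1]
    nlinarith [ht.2]
  -- the linear part `t * f' 0` is reproduced exactly by the interpolation
  have key2 : ∀ t ∈ Icc (0 : ℝ) 1, ‖(f t - t * f' 0) - (f 0 - (0 : ℝ) * f' 0)‖ ≤ M := fun t ht => by
    have := Convex.norm_image_sub_le_of_norm_hasDerivWithin_le (f := fun t : ℝ => f t - t * f' 0)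
      (f' := fun t => f' t - 1 * f' 0)
      (fun x hx => ((hf x hx).sub
        ((hasDerivAt_id x).ofReal_comp.mul_const (f' 0))).hasDerivWithinAt)
      (fun x hx => by simpa using key1 x hx) (convex_Icc 0 1) h0 ht
    refine this.trans ?_
    rw [sub_zero, Real.norm_of_nonneg ht.1]
    nlinarith [ht.2]
  have e : f q - (1 - q) * f 0 - q * f 1 = ((f q - q * f' 0) - (f 0 - (0 : ℝ) * f' 0))
      - q * ((f 1 - (1 : ℝ) * f' 0) - (f 0 - (0 : ℝ) * f' 0)) := by
    push_cast; ring
  rw [e]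
  refine (norm_sub_le _ _).trans ?_
  rw [norm_mul, Complex.norm_of_nonneg hq.1]
  have := key2 q hq
  have := key2 1 h1
  nlinarith [hq.1, hq.2, norm_nonneg ((f 1 - (1 : ℝ) * f' 0) - (f 0 - (0 : ℝ) * f' 0))]

/-- The error at `t = q` of the linear interpolation of `t ↦ (n + 1 + t)^(-s)` between `t = 0` and
`t = 1`. It is `O(n^(-Re s - 2))`. -/
noncomputable def interpError (q : ℝ) (n : ℕ) (s : ℂ) : ℂ :=
  ((n : ℂ) + 1 + q) ^ (-s) - (1 - q) * ((n : ℂ) + 1) ^ (-s) - q * ((n : ℂ) + 2) ^ (-s)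

lemma norm_interpError_le {q : ℝ} (hq : q ∈ Icc (0 : ℝ) 1) (n : ℕ) {s : ℂ} (hs : -(1 / 2) < s.re)
    (hs' : ‖s‖ ≤ 4) : ‖interpError q n s‖ ≤ 40 * ((n : ℝ) + 1) ^ (-(3 / 2) : ℝ) := by
  have hpos : ∀ t ∈ Icc (0 : ℝ) 1, ((n : ℂ) + 1 + t) ∈ slitPlane := fun t ht => by
    left
    simp
    have := ht.1
    positivity
  have hd : ∀ (r : ℂ), ∀ t ∈ Icc (0 : ℝ) 1, HasDerivAt (fun t : ℝ => ((n : ℂ) + 1 + t) ^ r)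
      (r * ((n : ℂ) + 1 + t) ^ (r - 1)) t := fun r t ht => by
    have := (((hasDerivAt_id (t : ℂ)).const_add ((n : ℂ) + 1)).cpow_const (c := r)
      (hpos t ht)).comp_ofReal
    simpa using this
  have := norm_sub_linear_interpolation_le (M := 20 * ((n : ℝ) + 1) ^ (-(3 / 2) : ℝ))
    (hd (-s)) (fun t ht => (hd (-s - 1) t ht).const_mul (-s)) (fun t ht => ?_) hq
  · have h2 : (n : ℂ) + 1 + 1 = n + 2 := by ring
    simp only [ofReal_zero, add_zero, ofReal_one, h2] at this
    unfold interpError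
    linarith
  · have h1 : 0 < (n : ℝ) + 1 + t := by have := ht.1; positivity
    have h2 : ((n : ℂ) + 1 + t) = (((n : ℝ) + 1 + t : ℝ) : ℂ) := by push_cast; ring
    rw [norm_mul, norm_mul, h2, norm_cpow_eq_rpow_re_of_pos h1, norm_neg]
    have h3 : ‖-s - 1‖ ≤ 5 := by
      refine (norm_sub_le _ _).trans ?_
      rw [norm_neg, norm_one]; linarith
    have h4 : ((n : ℝ) + 1 + t) ^ (-s - 1 - 1).re ≤ ((n : ℝ) + 1) ^ (-(3 / 2) : ℝ) := by
      calc ((n : ℝ) + 1 + t) ^ (-s - 1 - 1).re ≤ ((n : ℝ) + 1 + t) ^ (-(3 / 2) : ℝ) := by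
            apply Real.rpow_le_rpow_of_exponent_le
            · have := ht.1
              have : (0 : ℝ) ≤ n := by positivity
              linarith
            · simp; linarith
        _ ≤ _ := Real.rpow_le_rpow_of_nonpos (by positivity) (by linarith [ht.1]) (by norm_num)
    calc ‖s‖ * (‖-s - 1‖ * ((n : ℝ) + 1 + t) ^ (-s - 1 - 1).re)
        ≤ 4 * (5 * ((n : ℝ) + 1) ^ (-(3 / 2) : ℝ)) := by gcongr
      _ = _ := by ring

lemma summable_interpError_bound :
    Summable (fun n : ℕ => 40 * ((n : ℝ) + 1) ^ (-(3 / 2) : ℝ)) := by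
  have h : Summable (fun n : ℕ => (n : ℝ) ^ (-(3 / 2) : ℝ)) := by
    rw [Real.summable_nat_rpow]; norm_num
  have := (summable_nat_add_iff 1).mpr h
  simpa using this.mul_left 40

lemma hasDerivAt_interpError (q : ℝ) (hq : 0 ≤ q) (n : ℕ) (s : ℂ) :
    HasDerivAt (interpError q n)
      (((n : ℂ) + 1 + q) ^ (-s) * log ((n : ℂ) + 1 + q) * (-1)
        - (1 - q) * (((n : ℂ) + 1) ^ (-s) * log ((n : ℂ) + 1) * (-1))
        - q * (((n : ℂ) + 2) ^ (-s) * log ((n : ℂ) + 2) * (-1))) s := by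
  have h : ∀ z : ℂ, z ≠ 0 → HasDerivAt (fun s : ℂ => z ^ (-s)) (z ^ (-s) * log z * (-1)) s :=
    fun z hz => (hasDerivAt_neg s).const_cpow (Or.inl hz)
  have h1 : (n : ℂ) + 1 + q ≠ 0 := by
    have : (n : ℂ) + 1 + q = ((n + 1 + q : ℝ) : ℂ) := by push_cast; ring
    rw [this]
    exact_mod_cast (by positivity : (0 : ℝ) < n + 1 + q).ne'
  have h2 : (n : ℂ) + 1 ≠ 0 := by exact_mod_cast n.succ_ne_zero
  have h3 : (n : ℂ) + 2 ≠ 0 := by exact_mod_cast (by omega : n + 2 ≠ 0)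
  exact ((h _ h1).sub ((h _ h2).const_mul _)).sub ((h _ h3).const_mul _)

/-- The weights `1 - q` and `q` recombine the shifted series of `ζ(s)` into `ζ(s) - q`. -/
lemma hurwitzZeta_eq_tsum_interpError_of_one_lt_re {q : ℝ} (hq : q ∈ Ioo (0 : ℝ) 1) {s : ℂ}
    (hs : 1 < s.re) :
    HurwitzZeta.hurwitzZeta q s - HurwitzZeta.hurwitzZeta (0 : UnitAddCircle) s =
      (q : ℂ) ^ (-s) - q + ∑' n, interpError q n s := by
  have e1 := HurwitzZeta.hasSum_hurwitzZeta_of_one_lt_re (Ioo_subset_Icc_self hq) hs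
  have e2 := HurwitzZeta.hasSum_hurwitzZeta_of_one_lt_re (a := 1) (by simp) hs
  have e3 : ((1 : ℝ) : UnitAddCircle) = 0 := AddCircle.coe_period 1
  rw [e3] at e2
  have f1 := (hasSum_nat_add_iff' 1).mpr e1
  have f2 := (hasSum_nat_add_iff' 1).mpr e2
  have := ((f1.sub (e2.mul_left (1 - (q : ℂ)))).sub (f2.mul_left (q : ℂ))).tsum_eq
  have e4 : ∀ n : ℕ, interpError q n s = 1 / (((n + 1 : ℕ) : ℂ) + q) ^ s
      - (1 - q) * (1 / ((n : ℂ) + (1 : ℝ)) ^ s) - q * (1 / (((n + 1 : ℕ) : ℂ) + (1 : ℝ)) ^ s) := by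
    intro n
    have h2 : (n : ℂ) + 2 = n + 1 + 1 := by ring
    unfold interpError
    simp only [one_div, ← cpow_neg, h2]
    push_cast
    rfl
  rw [tsum_congr e4, this]
  simp [cpow_neg]
  ring

/-- Linear interpolation of `t ↦ (n + t)^(-s)` at `t = q` continues the series of
`ζ(s, q) - ζ(s)` to a neighbourhood of `s = 0`. -/
lemma hurwitzZeta_eq_tsum_interpError {q : ℝ} (hq : q ∈ Ioo (0 : ℝ) 1) :
    EqOn (fun s => HurwitzZeta.hurwitzZeta q s - HurwitzZeta.hurwitzZeta (0 : UnitAddCircle) s)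
      (fun s => (q : ℂ) ^ (-s) - q + ∑' n, interpError q n s)
      ({s : ℂ | -(1 / 2) < s.re} ∩ Metric.ball 0 4) := by
  have hU : IsOpen ({s : ℂ | -(1 / 2) < s.re} ∩ Metric.ball 0 4) :=
    (isOpen_lt continuous_const continuous_re).inter Metric.isOpen_ball
  have hq0 : (q : ℂ) ≠ 0 := by exact_mod_cast hq.1.ne'
  refine AnalyticOnNhd.eqOn_of_preconnected_of_eventuallyEq (𝕜 := ℂ) (z₀ := 3) ?_ ?_ ?_ ?_ ?_
  · have hd := HurwitzZeta.differentiable_hurwitzZeta_sub_hurwitzZeta (q : UnitAddCircle) 0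
    exact hd.differentiableOn.analyticOnNhd hU
  · refine DifferentiableOn.analyticOnNhd (DifferentiableOn.add ?_ ?_) hU
    · refine DifferentiableOn.sub_const (fun s _ => ?_) _
      exact ((hasDerivAt_neg s).const_cpow (Or.inl hq0)).differentiableAt.differentiableWithinAt
    · refine Complex.differentiableOn_tsum_of_summable_norm summable_interpError_bound
        (fun n s _ =>
          (hasDerivAt_interpError q hq.1.le n s).differentiableAt.differentiableWithinAt)
        hU (fun n s hs => norm_interpError_le (Ioo_subset_Icc_self hq) n hs.1 ?_)
      have := hs.2
      simp at this
      exact this.le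
  · exact ((convex_halfSpace_re_gt _).inter (convex_ball _ _)).isPreconnected
  · constructor
    · simp; norm_num
    · simp; norm_num
  · have : {s : ℂ | 1 < s.re} ∈ 𝓝 (3 : ℂ) :=
      (isOpen_lt continuous_const continuous_re).mem_nhds (by simp)
    filter_upwards [this] with s hs
    exact hurwitzZeta_eq_tsum_interpError_of_one_lt_re hq hs

/-- The derivatives of the interpolation errors at `s = 0` add up to the sequence in the limit
formula for `log Γ(q)`, up to terms with an evident limit. -/
lemma sum_range_deriv_interpError (q : ℝ) (N : ℕ) :
    ∑ n ∈ Finset.range N, (-Real.log (n + 1 + q) + (1 - q) * Real.log (n + 1)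
      + q * Real.log (n + 2)) =
    Real.BohrMollerup.logGammaSeq q N + Real.log q + q * (Real.log (N + 1) - Real.log N) := by
  have h1 : ∀ N : ℕ, ∑ n ∈ Finset.range N, (-Real.log (n + 1 + q) + (1 - q) * Real.log (n + 1)
      + q * Real.log (n + 2)) = Real.log N.factorial + q * Real.log (N + 1)
      - ∑ m ∈ Finset.range N, Real.log (q + (m + 1 : ℕ)) := by
    intro N
    induction N with
    | zero => simp
    | succ N ih =>
      rw [Finset.sum_range_succ, ih, Finset.sum_range_succ, Nat.factorial_succ]
      have : (N : ℝ) + 1 ≠ 0 := by positivity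
      push_cast
      rw [Real.log_mul this (by exact_mod_cast N.factorial_ne_zero),
        show (N : ℝ) + 1 + 1 = N + 2 by ring, show q + ((N : ℝ) + 1) = N + 1 + q by ring]
      ring
  rw [h1, Real.BohrMollerup.logGammaSeq, Finset.sum_range_succ']
  simp
  ring

/-- Lerch's formula `ζ'(0, q) = log Γ(q) - log (2π) / 2`. -/
theorem deriv_hurwitzZeta_zero {q : ℝ} (hq : q ∈ Ioo (0 : ℝ) 1) :
    deriv (HurwitzZeta.hurwitzZeta (q : UnitAddCircle)) 0 =
      (Real.log (Real.Gamma q) - Real.log (2 * Real.pi) / 2 : ℝ) := by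
  have hU : IsOpen ({s : ℂ | -(1 / 2) < s.re} ∩ Metric.ball 0 4) :=
    (isOpen_lt continuous_const continuous_re).inter Metric.isOpen_ball
  have h0 : (0 : ℂ) ∈ ({s : ℂ | -(1 / 2) < s.re} ∩ Metric.ball 0 4) := by
    constructor
    · simp
    · simp
  have hq0 : (q : ℂ) ≠ 0 := by exact_mod_cast hq.1.ne'
  have hb : ∀ (n : ℕ), ∀ w ∈ ({s : ℂ | -(1 / 2) < s.re} ∩ Metric.ball 0 4),
      ‖interpError q n w‖ ≤ 40 * ((n : ℝ) + 1) ^ (-(3 / 2) : ℝ) := fun n s hs =>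
    norm_interpError_le (Ioo_subset_Icc_self hq) n hs.1 (by
      have := hs.2
      simp at this
      exact this.le)
  have hdiff : ∀ n : ℕ, DifferentiableOn ℂ (interpError q n)
      ({s : ℂ | -(1 / 2) < s.re} ∩ Metric.ball 0 4) := fun n s _ =>
    (hasDerivAt_interpError q hq.1.le n s).differentiableAt.differentiableWithinAt
  have hsum := Complex.hasSum_deriv_of_summable_norm summable_interpError_bound hdiff hU hb h0
  have hterm : ∀ n : ℕ, deriv (interpError q n) 0 =
      ((-Real.log (n + 1 + q) + (1 - q) * Real.log (n + 1) + q * Real.log (n + 2) : ℝ) : ℂ) := by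
    intro n
    rw [(hasDerivAt_interpError q hq.1.le n 0).deriv]
    have := hq.1
    push_cast
    rw [ofReal_log (by positivity), ofReal_log (by positivity), ofReal_log (by positivity)]
    push_cast
    simp
  have hlim : Tendsto (fun N : ℕ => Real.BohrMollerup.logGammaSeq q N + Real.log q
      + q * (Real.log (N + 1) - Real.log N)) atTop
      (𝓝 (Real.log (Real.Gamma q) + Real.log q + q * 0)) :=
    ((Real.BohrMollerup.tendsto_log_gamma hq.1).add_const _).add
      (Real.tendsto_log_nat_add_one_sub_log.const_mul q)
  have hD : deriv (fun w => ∑' n, interpError q n w) 0 =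
      (Real.log (Real.Gamma q) + Real.log q + q * 0 : ℝ) := by
    refine tendsto_nhds_unique hsum.tendsto_sum_nat ?_
    refine ((continuous_ofReal.tendsto _).comp hlim).congr fun N => ?_
    rw [Finset.sum_congr rfl fun n _ => hterm n, ← ofReal_sum, sum_range_deriv_interpError]
    rfl
  have hser : HasDerivAt (fun w => ∑' n, interpError q n w)
      (Real.log (Real.Gamma q) + Real.log q + q * 0 : ℝ) 0 := by
    rw [← hD]
    exact ((Complex.differentiableOn_tsum_of_summable_norm summable_interpError_bound hdiff hU
      hb).differentiableAt (hU.mem_nhds h0)).hasDerivAt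
  have hpow : HasDerivAt (fun s : ℂ => (q : ℂ) ^ (-s) - q)
      ((q : ℂ) ^ (-(0 : ℂ)) * log q * (-1)) 0 :=
    ((hasDerivAt_neg (0 : ℂ)).const_cpow (Or.inl hq0)).sub_const _
  have heq := (hpow.add hser).congr_of_eventuallyEq
    ((hurwitzZeta_eq_tsum_interpError hq).eventuallyEq_of_mem (hU.mem_nhds h0))
  have hz : HasDerivAt (HurwitzZeta.hurwitzZeta (0 : UnitAddCircle))
      (-Complex.log (2 * Real.pi) / 2) 0 := by
    rw [HurwitzZeta.hurwitzZeta_zero, ← deriv_riemannZeta_zero]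
    exact (differentiableAt_riemannZeta (by norm_num)).hasDerivAt
  have := heq.add hz
  have e : ((fun s => HurwitzZeta.hurwitzZeta (q : UnitAddCircle) s
      - HurwitzZeta.hurwitzZeta (0 : UnitAddCircle) s)
      + HurwitzZeta.hurwitzZeta (0 : UnitAddCircle)) = HurwitzZeta.hurwitzZeta q := by
    ext s; simp
  rw [e] at this
  rw [this.deriv]
  push_cast
  rw [ofReal_log hq.1.le, ofReal_log (by positivity : 0 ≤ 2 * Real.pi)]
  push_cast
  simp
  ring

end Tornheim

/-! ### The functions `A_k` for `k ≥ 2` via the functional equation -/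

namespace Tornheim

open Complex Filter Topology Set

lemma coe_one_sub (q : ℝ) : ((1 - q : ℝ) : UnitAddCircle) = -(q : UnitAddCircle) := by
  have : ((1 : ℝ) : UnitAddCircle) = 0 := AddCircle.coe_period 1
  rw [AddCircle.coe_sub, this, zero_sub]

lemma eventually_hurwitzZeta_one_sub {k : ℕ} (hk : 2 ≤ k) (a : UnitAddCircle) :
    ∀ᶠ s in 𝓝 (k : ℂ), HurwitzZeta.hurwitzZeta a (1 - s) = (2 * Real.pi) ^ (-s) * Gamma s *
      (exp (-Real.pi * I * s / 2) * HurwitzZeta.expZeta a s +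
        exp (Real.pi * I * s / 2) * HurwitzZeta.expZeta (-a) s) := by
  have : {s : ℂ | 1 < s.re} ∈ 𝓝 (k : ℂ) :=
    (isOpen_lt continuous_const continuous_re).mem_nhds (by simp; omega)
  filter_upwards [this] with s hs
  have hs' : 1 < s.re := hs
  refine HurwitzZeta.hurwitzZeta_one_sub a (fun n h => ?_) (Or.inr fun h => ?_)
  · rw [h] at hs'
    simp at hs'
    have : (0 : ℝ) ≤ n := by positivity
    linarith
  · rw [h] at hs'
    simp at hs'

lemma hasDerivAt_hurwitzZeta_comp_one_sub {k : ℕ} (hk : 2 ≤ k) (a : UnitAddCircle) :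
    HasDerivAt (fun s => HurwitzZeta.hurwitzZeta a (1 - s))
      (-deriv (HurwitzZeta.hurwitzZeta a) (1 - (k : ℂ))) (k : ℂ) := by
  have h1 : (1 - (k : ℂ)) ≠ 1 := by
    simp
    omega
  have := (HurwitzZeta.differentiableAt_hurwitzZeta a h1).hasDerivAt.comp (k : ℂ)
    ((hasDerivAt_id (k : ℂ)).const_sub 1)
  simpa [Function.comp_def] using this

lemma hasDerivAt_expZeta {k : ℕ} (hk : 2 ≤ k) (a : UnitAddCircle) :
    HasDerivAt (HurwitzZeta.expZeta a) (deriv (HurwitzZeta.expZeta a) k) (k : ℂ) :=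
  (HurwitzZeta.differentiableAt_expZeta a k (Or.inl (by exact_mod_cast (by omega)))).hasDerivAt

lemma exp_pi_mul_I_mul_nat (k : ℕ) : exp (Real.pi * I * k / 2) = I ^ k := by
  conv_rhs => rw [← exp_pi_div_two_mul_I, ← exp_nat_mul]
  congr 1
  ring

lemma exp_neg_pi_mul_I_mul_nat (k : ℕ) : exp (-Real.pi * I * k / 2) = (-I) ^ k := by
  conv_rhs => rw [← exp_neg_pi_div_two_mul_I, ← exp_nat_mul]
  congr 1
  ring

lemma differentiableAt_gammaFactor {k : ℕ} (hk : 2 ≤ k) :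
    DifferentiableAt ℂ (fun s : ℂ => (2 * Real.pi : ℂ) ^ (-s) * Gamma s) k := by
  have h2 : (2 * Real.pi : ℂ) ≠ 0 := by
    simp [Real.pi_ne_zero]
  refine DifferentiableAt.mul ?_ (differentiableAt_Gamma _ fun m h => ?_)
  · exact ((hasDerivAt_neg _).const_cpow (Or.inl h2)).differentiableAt
  · have : (k : ℂ) + m = 0 := by rw [h]; ring
    have : k + m = 0 := by exact_mod_cast this
    omega

/-- In the combination of `A k q` and `A k (1 - q)` of parity `(-1)^(k+1)`, the derivatives of the
exponential zeta function cancel. -/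
lemma A_sub_neg_one_pow_mul_A {k : ℕ} (hk : 2 ≤ k) (q : ℝ) :
    A k q - (-1) ^ k * A k (1 - q) = k.factorial * (Real.pi * I) / (2 * Real.pi * I) ^ k *
      (HurwitzZeta.expZeta q k - (-1) ^ k * HurwitzZeta.expZeta (-q : UnitAddCircle) k) := by
  set a : UnitAddCircle := (q : UnitAddCircle) with ha
  have hL := (hasDerivAt_hurwitzZeta_comp_one_sub hk a).sub
    ((hasDerivAt_hurwitzZeta_comp_one_sub hk (-a)).const_mul ((-1 : ℂ) ^ k))
  have hG : DifferentiableAt ℂ (fun s => (2 * Real.pi : ℂ) ^ (-s) * Gamma s *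
      (HurwitzZeta.expZeta a s - (-1) ^ k * HurwitzZeta.expZeta (-a) s)) (k : ℂ) :=
    (differentiableAt_gammaFactor hk).mul ((hasDerivAt_expZeta hk a).differentiableAt.sub
      ((hasDerivAt_expZeta hk (-a)).differentiableAt.const_mul _))
  have he : ∀ c : ℂ, HasDerivAt (fun s : ℂ => exp (c * s / 2)) (exp (c * k / 2) * (c * 1 / 2))
      (k : ℂ) := fun c => (((hasDerivAt_id (k : ℂ)).const_mul c).div_const 2).cexp
  have hh := (he (-Real.pi * I)).sub ((he (Real.pi * I)).const_mul ((-1 : ℂ) ^ k))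
  -- the difference of the two functional equations factors, and the second factor vanishes at `k`
  have hR := hG.hasDerivAt.mul hh
  have hsq : ((-1 : ℂ) ^ k) * (-1) ^ k = 1 := by rw [← mul_pow]; simp
  have heq := hR.congr_of_eventuallyEq (f₁ := (fun s => HurwitzZeta.hurwitzZeta a (1 - s)) -
    (fun s => (-1 : ℂ) ^ k * HurwitzZeta.hurwitzZeta (-a) (1 - s))) (by
      filter_upwards [eventually_hurwitzZeta_one_sub hk a, eventually_hurwitzZeta_one_sub hk (-a)]
        with s h1 h2
      simp only [Pi.sub_apply, Pi.mul_apply]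
      rw [h1, h2, neg_neg]
      linear_combination (2 * Real.pi : ℂ) ^ (-s) * Gamma s * exp (Real.pi * I * s / 2) *
        HurwitzZeta.expZeta (-a) s * (-hsq))
  have hu := hL.unique heq
  have hI : (-1 : ℂ) ^ k * I ^ k = (-I) ^ k := by rw [← mul_pow]; simp
  have hI' : (-I) ^ k * I ^ k = 1 := by rw [← mul_pow]; simp
  simp only [Pi.sub_apply, exp_pi_mul_I_mul_nat, exp_neg_pi_mul_I_mul_nat, hI, sub_self,
    mul_zero, zero_add] at hu
  have hfac : (k : ℂ) * Gamma k = k.factorial := by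
    obtain ⟨m, rfl⟩ : ∃ m, k = m + 1 := ⟨k - 1, by omega⟩
    push_cast
    rw [Gamma_nat_eq_factorial, Nat.factorial_succ]
    push_cast
    ring
  have h2 : (2 * Real.pi : ℂ) ≠ 0 := by
    simp [Real.pi_ne_zero]
  rw [cpow_neg, cpow_natCast] at hu
  have hA : A k q - (-1) ^ k * A k (1 - q) =
      -k * (-deriv (HurwitzZeta.hurwitzZeta a) (1 - (k : ℂ)) -
        (-1) ^ k * -deriv (HurwitzZeta.hurwitzZeta (-a)) (1 - (k : ℂ))) := by
    unfold A
    rw [coe_one_sub]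
    ring
  have hP : (2 * Real.pi : ℂ) ^ k ≠ 0 := pow_ne_zero _ h2
  have hinv : ((2 * Real.pi * I : ℂ) ^ k)⁻¹ = ((2 * Real.pi : ℂ) ^ k)⁻¹ * (-I) ^ k := by
    rw [mul_pow (2 * Real.pi : ℂ) I, mul_inv, inv_eq_of_mul_eq_one_left hI']
  rw [hA, hu, ← hfac, div_eq_mul_inv _ ((2 * Real.pi * I : ℂ) ^ k), hinv]
  linear_combination ((k : ℂ) * ((2 * Real.pi : ℂ) ^ k)⁻¹ * Gamma k * (HurwitzZeta.expZeta a k -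
    (-1) ^ k * HurwitzZeta.expZeta (-a) k) * (Real.pi * I / 2)) * hI

/-- Only the shape of this formula matters: the coefficients do not depend on `q`, so that `A k` is
continuous. -/
lemma A_eq_expZeta {k : ℕ} (hk : 2 ≤ k) : ∃ α β γ δ : ℂ, ∀ q : ℝ, A k q =
    α * HurwitzZeta.expZeta q k + β * HurwitzZeta.expZeta (-q : UnitAddCircle) k +
    γ * deriv (HurwitzZeta.expZeta q) k +
    δ * deriv (HurwitzZeta.expZeta (-q : UnitAddCircle)) k := by
  have hd : ∀ c : ℂ, DifferentiableAt ℂ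
      (fun s : ℂ => (2 * Real.pi : ℂ) ^ (-s) * Gamma s * exp (c * s / 2)) k := fun c =>
    (differentiableAt_gammaFactor hk).mul
      (((hasDerivAt_id (k : ℂ)).const_mul c).div_const 2).cexp.differentiableAt
  set g₁ : ℂ → ℂ := fun s => (2 * Real.pi : ℂ) ^ (-s) * Gamma s * exp (-Real.pi * I * s / 2)
  set g₂ : ℂ → ℂ := fun s => (2 * Real.pi : ℂ) ^ (-s) * Gamma s * exp (Real.pi * I * s / 2)
  have h1 : DifferentiableAt ℂ g₁ k := hd _
  have h2 : DifferentiableAt ℂ g₂ k := hd _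
  refine ⟨-k * deriv g₁ k, -k * deriv g₂ k, -k * g₁ k, -k * g₂ k, fun q => ?_⟩
  have hR := (h1.hasDerivAt.mul (hasDerivAt_expZeta hk q)).add
    (h2.hasDerivAt.mul (hasDerivAt_expZeta hk (-q)))
  have hu := (hasDerivAt_hurwitzZeta_comp_one_sub hk q).unique (hR.congr_of_eventuallyEq (by
    filter_upwards [eventually_hurwitzZeta_one_sub hk q] with s hs
    rw [hs]
    simp only [Pi.add_apply, Pi.mul_apply, g₁, g₂]
    ring))
  have : A k q = -k * (-deriv (HurwitzZeta.hurwitzZeta q) (1 - (k : ℂ))) := by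
    unfold A; ring
  rw [this, hu]
  ring

lemma norm_exp_two_pi_I_mul (q : ℝ) (n : ℕ) : ‖exp (2 * Real.pi * I * q * n)‖ = 1 := by
  have : (2 * Real.pi * I * q * n : ℂ) = ((2 * Real.pi * q * n : ℝ) : ℂ) * I := by
    push_cast; ring
  rw [this, norm_exp_ofReal_mul_I]

lemma continuous_expZeta {k : ℕ} (hk : 2 ≤ k) :
    Continuous fun q : ℝ => HurwitzZeta.expZeta q k := by
  have hs : 1 < (k : ℂ).re := by simp; omega
  have h : ∀ q : ℝ, HurwitzZeta.expZeta q k =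
      ∑' n : ℕ, exp (2 * Real.pi * I * q * n) / n ^ (k : ℂ) := fun q =>
    (HurwitzZeta.hasSum_expZeta_of_one_lt_re q hs).tsum_eq.symm
  simp_rw [h]
  refine continuous_tsum (u := fun n : ℕ => 1 / (n : ℝ) ^ k) (fun n => by fun_prop)
    (Real.summable_one_div_nat_pow.mpr (by omega)) fun n q => ?_
  rw [norm_div, norm_exp_two_pi_I_mul, cpow_natCast, norm_pow, norm_natCast]

lemma continuous_deriv_expZeta {k : ℕ} (hk : 2 ≤ k) :
    Continuous fun q : ℝ => deriv (HurwitzZeta.expZeta q) k := by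
  have hs : 1 < (k : ℂ).re := by simp; omega
  have hab : ∀ f : ℕ → ℂ, (∀ n, ‖f n‖ ≤ 1) → LSeries.abscissaOfAbsConv f < (k : ℂ).re :=
    fun f hf => (LSeries.abscissaOfAbsConv_le_of_le_const ⟨1, fun n _ => hf n⟩).trans_lt
      (by exact_mod_cast hs)
  have h : ∀ q : ℝ, deriv (HurwitzZeta.expZeta q) k = -∑' n : ℕ,
      LSeries.term (LSeries.logMul fun m => exp (2 * Real.pi * I * q * m)) k n := fun q => by
    rw [← LSeries, ← (LSeries_hasDerivAt (hab _ fun n => (norm_exp_two_pi_I_mul q n).le)).deriv]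
    refine EventuallyEq.deriv_eq ?_
    have : {s : ℂ | 1 < s.re} ∈ 𝓝 (k : ℂ) :=
      (isOpen_lt continuous_const continuous_re).mem_nhds hs
    filter_upwards [this] with s hs
    exact (HurwitzZeta.LSeriesHasSum_exp q hs).LSeries_eq.symm
  simp_rw [h]
  refine (continuous_tsum (u := fun n : ℕ => ‖LSeries.term (LSeries.logMul 1) k n‖) (fun n => ?_)
    ?_ fun n q => ?_).neg
  · simp only [LSeries.term, LSeries.logMul]
    split_ifs
    · exact continuous_const
    · fun_prop
  · exact (LSeriesSummable_logMul_of_lt_re (hab 1 fun n => by simp)).norm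
  · simp only [LSeries.term, LSeries.logMul]
    split_ifs
    · rfl
    · simp [norm_exp_two_pi_I_mul]

lemma continuous_A {k : ℕ} (hk : 2 ≤ k) : Continuous (A k) := by
  obtain ⟨α, β, γ, δ, h⟩ := A_eq_expZeta hk
  have h1 := (continuous_expZeta hk).comp continuous_neg
  have h2 := (continuous_deriv_expZeta hk).comp continuous_neg
  have e : A k = _ := funext h
  rw [e]
  simp only [Function.comp_def, AddCircle.coe_neg] at h1 h2
  exact (((continuous_const.mul (continuous_expZeta hk)).add (continuous_const.mul h1)).add
    (continuous_const.mul (continuous_deriv_expZeta hk))).add (continuous_const.mul h2)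

end Tornheim

/-! ### Endpoint singularities and integrability -/

namespace Tornheim

open Complex Filter Topology Set

/-- The weight `(q (1 - q))^(-1/4)`, whose cube is integrable over `(0, 1)`. -/
noncomputable def endpointWeight (q : ℝ) : ℝ := (q * (1 - q)) ^ (-(1 / 4) : ℝ)

lemma one_le_endpointWeight {q : ℝ} (hq : q ∈ Ioo (0 : ℝ) 1) : 1 ≤ endpointWeight q :=
  Real.one_le_rpow_of_pos_of_le_one_of_nonpos (mul_pos hq.1 (by linarith [hq.2]))
    (by nlinarith [hq.1, hq.2]) (by norm_num)

lemma endpointWeight_one_sub (q : ℝ) : endpointWeight (1 - q) = endpointWeight q := by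
  unfold endpointWeight
  congr 1
  ring

lemma abs_log_le_endpointWeight {q : ℝ} (hq : q ∈ Ioo (0 : ℝ) 1) :
    |Real.log (q * (1 - q))| ≤ 4 * endpointWeight q := by
  have hp : 0 < q * (1 - q) := mul_pos hq.1 (by linarith [hq.2])
  have h := Real.abs_log_mul_self_rpow_lt (q * (1 - q)) (1 / 4) hp
    (by nlinarith [hq.1, hq.2]) (by norm_num)
  have h2 : 0 < (q * (1 - q)) ^ (1 / 4 : ℝ) := Real.rpow_pos_of_pos hp _
  rw [abs_mul, abs_of_pos h2] at h
  unfold endpointWeight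
  rw [Real.rpow_neg hp.le, ← div_eq_mul_inv, le_div_iff₀ h2]
  norm_num at h ⊢
  exact h.le

lemma intervalIntegrable_endpointWeight_pow_three :
    IntervalIntegrable (fun q => endpointWeight q ^ 3) volume 0 1 := by
  have h := (betaIntegral_convergent (u := 1 / 4) (v := 1 / 4) (by norm_num) (by norm_num)).norm
  rw [intervalIntegrable_iff_integrableOn_Ioo_of_le zero_le_one] at h ⊢
  refine h.congr_fun (fun q hq => ?_) measurableSet_Ioo
  have h1 : 0 < 1 - q := by linarith [hq.2]
  have e : (1 - (q : ℂ)) = ((1 - q : ℝ) : ℂ) := by push_cast; rfl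
  simp only
  rw [norm_mul, e, norm_cpow_eq_rpow_re_of_pos hq.1, norm_cpow_eq_rpow_re_of_pos h1,
    ← Real.mul_rpow hq.1.le h1.le]
  unfold endpointWeight
  rw [← Real.rpow_natCast, ← Real.rpow_mul (mul_pos hq.1 h1).le]
  congr 1
  norm_num

/-- Functions continuous on `(0, 1)` and bounded there by a multiple of `(q (1 - q))^(-1/4)`.
This covers logarithmic singularities at the endpoints, and products of three such functions are
integrable. -/
def MildAtEndpoints (f : ℝ → ℂ) : Prop :=
  ContinuousOn f (Ioo 0 1) ∧ ∃ K, ∀ q ∈ Ioo (0 : ℝ) 1, ‖f q‖ ≤ K * endpointWeight q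

namespace MildAtEndpoints

variable {f g h : ℝ → ℂ}

lemma of_continuous (hf : Continuous f) : MildAtEndpoints f := by
  refine ⟨hf.continuousOn, ?_⟩
  obtain ⟨K, hK⟩ := (isCompact_Icc (a := (0 : ℝ)) (b := 1)).exists_bound_of_continuousOn
    hf.continuousOn
  refine ⟨K, fun q hq => ?_⟩
  have h1 := hK q (Ioo_subset_Icc_self hq)
  have h2 := one_le_endpointWeight hq
  nlinarith [norm_nonneg (f q)]

lemma congr (hf : MildAtEndpoints f) (hfg : EqOn g f (Ioo 0 1)) : MildAtEndpoints g := by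
  refine ⟨hf.1.congr hfg, ?_⟩
  obtain ⟨K, hK⟩ := hf.2
  exact ⟨K, fun q hq => by rw [hfg hq]; exact hK q hq⟩

lemma add (hf : MildAtEndpoints f) (hg : MildAtEndpoints g) : MildAtEndpoints (f + g) := by
  refine ⟨hf.1.add hg.1, ?_⟩
  obtain ⟨K, hK⟩ := hf.2
  obtain ⟨L, hL⟩ := hg.2
  refine ⟨K + L, fun q hq => (norm_add_le _ _).trans ?_⟩
  rw [add_mul]
  exact add_le_add (hK q hq) (hL q hq)

lemma const_smul (hf : MildAtEndpoints f) (c : ℂ) : MildAtEndpoints (c • f) := by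
  refine ⟨hf.1.const_smul c, ?_⟩
  obtain ⟨K, hK⟩ := hf.2
  refine ⟨‖c‖ * K, fun q hq => ?_⟩
  rw [Pi.smul_apply, norm_smul, mul_assoc]
  exact mul_le_mul_of_nonneg_left (hK q hq) (norm_nonneg c)

lemma comp_one_sub (hf : MildAtEndpoints f) : MildAtEndpoints fun q => f (1 - q) := by
  have hmaps : MapsTo (fun q : ℝ => 1 - q) (Ioo 0 1) (Ioo 0 1) := fun q hq =>
    ⟨by linarith [hq.2], by linarith [hq.1]⟩
  refine ⟨hf.1.comp (by fun_prop) hmaps, ?_⟩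
  obtain ⟨K, hK⟩ := hf.2
  refine ⟨K, fun q hq => ?_⟩
  rw [← endpointWeight_one_sub]
  exact hK _ (hmaps hq)

lemma intervalIntegrable_mul_mul (hf : MildAtEndpoints f) (hg : MildAtEndpoints g)
    (hh : MildAtEndpoints h) : IntervalIntegrable (fun q => f q * g q * h q) volume 0 1 := by
  obtain ⟨K, hK⟩ := hf.2
  obtain ⟨L, hL⟩ := hg.2
  obtain ⟨M, hM⟩ := hh.2
  have hw := intervalIntegrable_endpointWeight_pow_three.const_mul (K * L * M)
  rw [intervalIntegrable_iff_integrableOn_Ioo_of_le zero_le_one] at hw ⊢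
  refine Integrable.mono' hw
    (((hf.1.mul hg.1).mul hh.1).aestronglyMeasurable measurableSet_Ioo) ?_
  refine (ae_restrict_iff' measurableSet_Ioo).mpr (Eventually.of_forall fun q hq => ?_)
  have h1 := hK q hq
  have h2 := hL q hq
  have h3 := hM q hq
  have h4 := (norm_nonneg _).trans h1
  rw [norm_mul, norm_mul]
  calc ‖f q‖ * ‖g q‖ * ‖h q‖ ≤ (K * endpointWeight q) * (L * endpointWeight q) *
        (M * endpointWeight q) := by
        have h5 := (norm_nonneg _).trans h2
        gcongr
    _ = _ := by ring

end MildAtEndpoints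

lemma A_one {q : ℝ} (hq : q ∈ Ioo (0 : ℝ) 1) :
    A 1 q = (Real.log (Real.Gamma q) - Real.log (2 * Real.pi) / 2 : ℝ) := by
  rw [← deriv_hurwitzZeta_zero hq]
  simp [A]

lemma mildAtEndpoints_log : MildAtEndpoints fun q => (Real.log q : ℂ) := by
  constructor
  · exact continuous_ofReal.comp_continuousOn
      (Real.continuousOn_log.mono fun q hq => by simpa using hq.1.ne')
  · refine ⟨4, fun q hq => ?_⟩
    have h1 : 0 < 1 - q := by linarith [hq.2]
    refine le_trans ?_ (abs_log_le_endpointWeight hq)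
    rw [norm_real, Real.norm_eq_abs, Real.log_mul hq.1.ne' h1.ne']
    have := Real.log_neg hq.1 hq.2
    have := Real.log_neg h1 (by linarith [hq.1])
    rw [abs_of_neg (by linarith), abs_of_neg (by linarith)]
    linarith

lemma mildAtEndpoints_A {k : ℕ} (hk : 0 < k) : MildAtEndpoints (A k) := by
  obtain rfl | hk2 : k = 1 ∨ 2 ≤ k := by omega
  -- `log Γ(q) = log Γ(1 + q) - log q`, and the first term is continuous on `[0, 1]`
  · have hc : Continuous fun q : ℝ => (Real.log (Real.Gamma (1 + |q|)) : ℂ) := by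
      refine continuous_ofReal.comp (Continuous.log ?_ fun q => ?_)
      · refine continuous_iff_continuousAt.mpr fun q => ?_
        refine ContinuousAt.comp (f := fun q : ℝ => 1 + |q|) (g := Real.Gamma) ?_ (by fun_prop)
        refine (Real.differentiableAt_Gamma fun m h => ?_).continuousAt
        have := abs_nonneg q
        have : (0 : ℝ) ≤ m := by positivity
        linarith
      · exact (Real.Gamma_pos_of_pos (by positivity)).ne'
    have h := ((MildAtEndpoints.of_continuous hc).add (mildAtEndpoints_log.const_smul (-1))).add
      (MildAtEndpoints.of_continuous
        (continuous_const (y := ((-(Real.log (2 * Real.pi) / 2) : ℝ) : ℂ))))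
    refine h.congr fun q hq => ?_
    rw [A_one hq]
    simp only [Pi.add_apply, Pi.smul_apply, smul_eq_mul]
    rw [abs_of_pos hq.1, add_comm 1 q, Real.Gamma_add_one hq.1.ne',
      Real.log_mul hq.1.ne' (Real.Gamma_pos_of_pos hq.1).ne']
    push_cast
    ring
  · exact .of_continuous (continuous_A hk2)

lemma mildAtEndpoints_B (k : ℕ) : MildAtEndpoints (B k) :=
  .of_continuous (by unfold B bernoulliFun; fun_prop)

end Tornheim

/-! ### Boundary values of the polylogarithm -/

namespace Tornheim

open Complex Filter Topology Set

/-- The polylogarithm series `∑_{n ≥ 1} z^n / n^k`. -/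
noncomputable def polylog (k : ℕ) (z : ℂ) : ℂ := ∑' n : ℕ+, z ^ (n : ℕ) / (n : ℂ) ^ k

/-- The point `r e^{2πiq}` of the disc. -/
noncomputable def polar (r q : ℝ) : ℂ := r * exp (2 * Real.pi * I * q)

lemma norm_polar (r q : ℝ) : ‖polar r q‖ = |r| := by
  have h := norm_exp_two_pi_I_mul q 1
  simp only [Nat.cast_one, mul_one] at h
  rw [polar, norm_mul, h, mul_one, norm_real, Real.norm_eq_abs]

lemma continuous_polar_right (r : ℝ) : Continuous (polar r) := by
  unfold polar; fun_prop

lemma norm_polylog_term_le (k : ℕ) (z : ℂ) (n : ℕ+) :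
    ‖z ^ (n : ℕ) / (n : ℂ) ^ k‖ ≤ ‖z‖ ^ (n : ℕ) := by
  rw [norm_div, norm_pow, norm_pow, norm_natCast]
  exact div_le_self (by positivity) (one_le_pow₀ (by exact_mod_cast n.pos))

lemma summable_pow_pnat {r : ℝ} (h0 : 0 ≤ r) (h1 : r < 1) : Summable fun n : ℕ+ => r ^ (n : ℕ) :=
  (summable_geometric_of_lt_one h0 h1).comp_injective PNat.coe_injective

lemma hasSum_polylog (k : ℕ) {z : ℂ} (hz : ‖z‖ < 1) :
    HasSum (fun n : ℕ+ => z ^ (n : ℕ) / (n : ℂ) ^ k) (polylog k z) :=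
  ((summable_pow_pnat (norm_nonneg z) hz).of_norm_bounded (norm_polylog_term_le k z)).hasSum

lemma continuous_polylog_polar (k : ℕ) {r : ℝ} (h0 : 0 ≤ r) (h1 : r < 1) :
    Continuous fun q => polylog k (polar r q) := by
  unfold polylog
  refine continuous_tsum (u := fun n : ℕ+ => r ^ (n : ℕ)) (fun n => ?_) (summable_pow_pnat h0 h1)
    fun n q => ?_
  · have := continuous_polar_right r
    fun_prop
  · have := norm_polylog_term_le k (polar r q) n
    rwa [norm_polar, abs_of_nonneg h0] at this

lemma hasSum_pnat_iff {f : ℕ → ℂ} (h : f 0 = 0) {x : ℂ} :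
    HasSum (fun n : ℕ+ => f n) x ↔ HasSum f x := by
  refine PNat.coe_injective.hasSum_iff (f := f) fun n hn => ?_
  obtain rfl : n = 0 := by
    by_contra h0
    exact hn ⟨⟨n, Nat.pos_of_ne_zero h0⟩, rfl⟩
  exact h

lemma polylog_one {z : ℂ} (hz : ‖z‖ < 1) : polylog 1 z = -log (1 - z) := by
  have h := hasSum_taylorSeries_neg_log hz
  rw [← hasSum_pnat_iff (by simp)] at h
  rw [← h.tsum_eq]
  simp [polylog]

/-- The Bernoulli functions of index `k`, combined into the boundary value
`∑_{n ≥ 1} e^{2πinq} / n^k` of the polylogarithm. -/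
noncomputable def boundaryPolylog (k : ℕ) (q : ℝ) : ℂ :=
  -(2 * Real.pi * I) ^ k / (2 * k.factorial) *
    (B k q + I / Real.pi * (A k q - (-1) ^ k * A k (1 - q)))

lemma boundaryPolylog_one {q : ℝ} (hq : q ∈ Ioo (0 : ℝ) 1) :
    boundaryPolylog 1 q = -log (1 - exp (2 * Real.pi * I * q)) := by
  have hq' : 1 - q ∈ Ioo (0 : ℝ) 1 := ⟨by linarith [hq.2], by linarith [hq.1]⟩
  have hs : 0 < Real.sin (Real.pi * q) :=
    Real.sin_pos_of_pos_of_lt_pi (mul_pos Real.pi_pos hq.1) (by nlinarith [Real.pi_pos, hq.2])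
  -- `1 - e^{2πiq} = 2 sin(πq) e^{iπ(q - 1/2)}`
  have h1 : 1 - exp (2 * Real.pi * I * q) =
      ((2 * Real.sin (Real.pi * q) : ℝ) : ℂ) * exp ((Real.pi * (q - 1 / 2) : ℝ) * I) := by
    have e1 : exp (2 * Real.pi * I * q) = exp (Real.pi * q * I) * exp (Real.pi * q * I) := by
      rw [← exp_add]; congr 1; ring
    have e2 : exp ((Real.pi * (q - 1 / 2) : ℝ) * I) = exp (Real.pi * q * I) * (-I) := by
      rw [← exp_neg_pi_div_two_mul_I, ← exp_add]
      congr 1; push_cast; ring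
    have e3 : exp (Real.pi * q * I) * exp (-(Real.pi * q * I)) = 1 := by
      rw [← exp_add]; simp
    rw [e1, e2]
    push_cast
    rw [Complex.sin, neg_mul]
    linear_combination (-1 : ℂ) * e3 + (exp (Real.pi * q * I) * exp (-(Real.pi * q * I)) -
      exp (Real.pi * q * I) * exp (Real.pi * q * I)) * I_sq
  have h2 : log (1 - exp (2 * Real.pi * I * q)) =
      Real.log (2 * Real.sin (Real.pi * q)) + (Real.pi * (q - 1 / 2) : ℝ) * I := by
    have hp := Real.pi_pos
    rw [h1, log_ofReal_mul (by positivity) (exp_ne_zero _), log_exp]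
    · simp only [mul_im, ofReal_re, I_im, ofReal_im, I_re]
      nlinarith [hq.1]
    · simp only [mul_im, ofReal_re, I_im, ofReal_im, I_re]
      nlinarith [hq.2]
  have h3 : A 1 q + A 1 (1 - q) = -(Real.log (2 * Real.sin (Real.pi * q)) : ℂ) := by
    rw [A_one hq, A_one hq']
    have hG := congrArg Real.log (Real.Gamma_mul_Gamma_one_sub q)
    rw [Real.log_mul (Real.Gamma_pos_of_pos hq.1).ne' (Real.Gamma_pos_of_pos hq'.1).ne',
      Real.log_div Real.pi_ne_zero hs.ne'] at hG
    have e : Real.log (Real.Gamma q) - Real.log (2 * Real.pi) / 2 +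
        (Real.log (Real.Gamma (1 - q)) - Real.log (2 * Real.pi) / 2) =
        -Real.log (2 * Real.sin (Real.pi * q)) := by
      rw [Real.log_mul two_ne_zero Real.pi_ne_zero, Real.log_mul two_ne_zero hs.ne']
      linarith
    exact_mod_cast congrArg ((↑) : ℝ → ℂ) e
  have hpi : (Real.pi : ℂ) ≠ 0 := by exact_mod_cast Real.pi_ne_zero
  unfold boundaryPolylog
  rw [h2, pow_one (-1 : ℂ), neg_one_mul, sub_neg_eq_add, h3, B, bernoulliFun_one]
  push_cast
  simp
  field_simp
  linear_combination 2 * (Real.log (2 * Real.sin (Real.pi * q)) : ℂ) * I_sq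

lemma boundaryPolylog_eq_expZeta {k : ℕ} (hk : 2 ≤ k) {q : ℝ} (hq : q ∈ Ioo (0 : ℝ) 1) :
    boundaryPolylog k q = HurwitzZeta.expZeta q k := by
  have hs : 1 < (k : ℂ).re := by simp; omega
  have h1 := HurwitzZeta.hasSum_expZeta_of_one_lt_re q hs
  have h2 := HurwitzZeta.hasSum_expZeta_of_one_lt_re (-q) hs
  have h3 := hasSum_one_div_nat_pow_mul_fourier hk (Ioo_subset_Icc_self hq)
  have h4 := (h1.add (h2.mul_left ((-1) ^ k))).unique (h3.congr_fun fun n => by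
    rw [fourier_coe_apply, fourier_coe_apply, cpow_natCast]
    push_cast
    have e1 : 2 * Real.pi * I * -(n : ℂ) * q / 1 = 2 * Real.pi * I * -q * n := by ring
    have e2 : 2 * Real.pi * I * (n : ℂ) * q / 1 = 2 * Real.pi * I * q * n := by ring
    rw [e1, e2]
    ring)
  have hfac : (k.factorial : ℂ) ≠ 0 := by exact_mod_cast k.factorial_ne_zero
  have hpi : (Real.pi : ℂ) ≠ 0 := by exact_mod_cast Real.pi_ne_zero
  have hP : (2 * Real.pi * I : ℂ) ^ k ≠ 0 := pow_ne_zero _ (by simp [Real.pi_ne_zero])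
  unfold boundaryPolylog
  rw [A_sub_neg_one_pow_mul_A hk, B]
  have e : -(2 * Real.pi * I : ℂ) ^ k / (2 * k.factorial) * (bernoulliFun k q) =
      (1 / 2) * (-(2 * Real.pi * I : ℂ) ^ k / k.factorial * bernoulliFun k q) := by
    field_simp
  rw [mul_add, e, ← h4]
  rw [AddCircle.coe_neg]
  have e2 : -(2 * Real.pi * I : ℂ) ^ k / (2 * k.factorial) * (I / Real.pi *
      (k.factorial * (Real.pi * I) / (2 * Real.pi * I) ^ k *
      (HurwitzZeta.expZeta q k - (-1) ^ k * HurwitzZeta.expZeta (-q : UnitAddCircle) k))) =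
      1 / 2 * (HurwitzZeta.expZeta q k -
        (-1) ^ k * HurwitzZeta.expZeta (-q : UnitAddCircle) k) := by
    generalize (2 * Real.pi * I : ℂ) ^ k = P at hP ⊢
    field_simp
    rw [I_sq]
    ring
  rw [e2]
  ring

lemma eventually_nonneg_and_lt_one : ∀ᶠ r : ℝ in 𝓝[<] 1, 0 ≤ r ∧ r < 1 :=
  mem_of_superset (Ioo_mem_nhdsLT zero_lt_one) fun _ hr => ⟨hr.1.le, hr.2⟩

lemma tendsto_polylog_polar {k : ℕ} (hk : 0 < k) {q : ℝ} (hq : q ∈ Ioo (0 : ℝ) 1) :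
    Tendsto (fun r => polylog k (polar r q)) (𝓝[<] 1) (𝓝 (boundaryPolylog k q)) := by
  have hpol : Continuous fun r => polar r q := by unfold polar; fun_prop
  obtain rfl | hk2 : k = 1 ∨ 2 ≤ k := by omega
  · rw [boundaryPolylog_one hq]
    have hsl : 1 - polar 1 q ∈ slitPlane := by
      left
      have h1 : (1 - polar 1 q).re = 1 - Real.cos (2 * Real.pi * q) := by
        have e : (2 * Real.pi * I * q : ℂ) = ((2 * Real.pi * q : ℝ) : ℂ) * I := by push_cast; ring
        simp only [polar, e, ofReal_one, one_mul, sub_re, one_re, exp_ofReal_mul_I_re]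
      rw [h1, show 2 * Real.pi * q = 2 * (Real.pi * q) by ring, Real.cos_two_mul, Real.cos_sq']
      have hs : 0 < Real.sin (Real.pi * q) :=
        Real.sin_pos_of_pos_of_lt_pi (mul_pos Real.pi_pos hq.1) (by nlinarith [Real.pi_pos, hq.2])
      nlinarith
    have h : Tendsto (fun r => -log (1 - polar r q)) (𝓝[<] 1) (𝓝 (-log (1 - polar 1 q))) :=
      (((continuous_const.sub hpol).tendsto 1).clog hsl).neg.mono_left nhdsWithin_le_nhds
    have e : polar 1 q = exp (2 * Real.pi * I * q) := by simp [polar]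
    rw [e] at h
    refine h.congr' ?_
    filter_upwards [eventually_nonneg_and_lt_one] with r hr
    rw [polylog_one]
    rw [norm_polar, abs_of_nonneg hr.1]
    exact hr.2
  · rw [boundaryPolylog_eq_expZeta hk2 hq]
    have hs : 1 < (k : ℂ).re := by simp; omega
    have h1 := HurwitzZeta.hasSum_expZeta_of_one_lt_re q hs
    rw [← hasSum_pnat_iff (by simp; omega)] at h1
    rw [← h1.tsum_eq]
    unfold polylog
    refine tendsto_tsum_of_dominated_convergence (bound := fun n : ℕ+ => 1 / (n : ℝ) ^ k) ?_ ?_ ?_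
    · exact (Real.summable_one_div_nat_pow.mpr (by omega)).comp_injective PNat.coe_injective
    · intro n
      have h2 : Continuous fun r => polar r q ^ (n : ℕ) / (n : ℂ) ^ k := by fun_prop
      have h3 := (h2.tendsto 1).mono_left (nhdsWithin_le_nhds (s := Iio 1))
      convert! h3 using 2
      rw [polar, ofReal_one, one_mul, ← exp_nat_mul, cpow_natCast]
      congr 2
      ring
    · filter_upwards [eventually_nonneg_and_lt_one] with r hr n
      rw [norm_div, norm_pow, norm_pow, norm_natCast, norm_polar, abs_of_nonneg hr.1]
      gcongr
      exact pow_le_one₀ hr.1 hr.2.le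

/-- The polylogarithm on circles of radius `r < 1` is bounded uniformly in the radius by a multiple
of `endpointWeight`; for `k = 1` this uses `-log (1 - z)` and `|1 - e^{iθ}| ≤ 2 |1 - r e^{iθ}|`. -/
lemma exists_norm_polylog_polar_le {k : ℕ} (hk : 0 < k) : ∃ K, ∀ r : ℝ, 0 ≤ r → r < 1 →
    ∀ q ∈ Ioo (0 : ℝ) 1, ‖polylog k (polar r q)‖ ≤ K * endpointWeight q := by
  obtain rfl | hk2 : k = 1 ∨ 2 ≤ k := by omega
  · refine ⟨4 + Real.log 2 + Real.pi, fun r h0 h1 q hq => ?_⟩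
    have hn : ‖polar r q‖ < 1 := by rwa [norm_polar, abs_of_nonneg h0]
    rw [polylog_one hn, norm_neg]
    have hq1 : 0 < 1 - q := by linarith [hq.2]
    have hp : 0 < q * (1 - q) := mul_pos hq.1 hq1
    have hsin : 2 * (q * (1 - q)) ≤ Real.sin (Real.pi * q) := by
      have hpi := Real.pi_pos
      rcases le_total q (1 / 2) with h | h
      · have := Real.mul_le_sin (x := Real.pi * q) (mul_pos hpi hq.1).le (by nlinarith)
        have e : 2 / Real.pi * (Real.pi * q) = 2 * q := by field_simp
        nlinarith [hq.1]
      · have := Real.mul_le_sin (x := Real.pi * (1 - q)) (mul_pos hpi hq1).le (by nlinarith)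
        have e : 2 / Real.pi * (Real.pi * (1 - q)) = 2 * (1 - q) := by field_simp
        have e2 : Real.sin (Real.pi * (1 - q)) = Real.sin (Real.pi * q) := by
          rw [mul_sub, mul_one, Real.sin_pi_sub]
        nlinarith [hq.1]
    have hone : ‖1 - polar 1 q‖ = 2 * Real.sin (Real.pi * q) := by
      have e : (2 * Real.pi * I * q : ℂ) = I * ((2 * (Real.pi * q) : ℝ) : ℂ) := by push_cast; ring
      rw [norm_sub_rev, polar, ofReal_one, one_mul, e, norm_exp_I_mul_ofReal_sub_one,
        mul_div_cancel_left₀ _ two_ne_zero, Real.norm_of_nonneg (by linarith)]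
    have hlow : q * (1 - q) ≤ ‖1 - polar r q‖ := by
      have t1 : ‖1 - polar 1 q‖ ≤ ‖1 - polar r q‖ + ‖polar r q - polar 1 q‖ :=
        norm_sub_le_norm_sub_add_norm_sub _ _ _
      have t2 : ‖polar r q - polar 1 q‖ = 1 - r := by
        have : polar r q - polar 1 q = polar (r - 1) q := by simp [polar]; ring
        rw [this, norm_polar, abs_of_nonpos (by linarith)]; ring
      have t3 : 1 - r ≤ ‖1 - polar r q‖ := by
        have := norm_sub_norm_le (1 : ℂ) (polar r q)
        rwa [norm_one, norm_polar, abs_of_nonneg h0] at this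
      linarith
    have hup : ‖1 - polar r q‖ ≤ 2 := by
      have := norm_sub_le (1 : ℂ) (polar r q)
      rw [norm_one] at this
      linarith
    have hpos := hp.trans_le hlow
    have hlog : |Real.log ‖1 - polar r q‖| ≤ 4 * endpointWeight q + Real.log 2 := by
      have l1 := Real.log_le_log hp hlow
      have l2 := Real.log_le_log hpos hup
      have l3 := (abs_le.mp (abs_log_le_endpointWeight hq)).1
      have l4 := one_le_endpointWeight hq
      have l5 := Real.log_pos (by norm_num : (1 : ℝ) < 2)
      rw [abs_le]
      constructor <;> linarith
    have h2 : ‖log (1 - polar r q)‖ ≤ |Real.log ‖1 - polar r q‖| + Real.pi := by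
      refine (norm_le_abs_re_add_abs_im _).trans ?_
      rw [log_re, log_im]
      gcongr
      exact abs_arg_le_pi _
    have l4 := one_le_endpointWeight hq
    have l5 := Real.log_pos (by norm_num : (1 : ℝ) < 2)
    nlinarith [Real.pi_pos]
  · have hsum : Summable fun n : ℕ+ => 1 / (n : ℝ) ^ k :=
      (Real.summable_one_div_nat_pow.mpr (by omega)).comp_injective PNat.coe_injective
    refine ⟨∑' n : ℕ+, 1 / (n : ℝ) ^ k, fun r h0 h1 q hq => ?_⟩
    have h3 : ‖polylog k (polar r q)‖ ≤ ∑' n : ℕ+, 1 / (n : ℝ) ^ k := by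
      refine tsum_of_norm_bounded hsum.hasSum fun n => ?_
      rw [norm_div, norm_pow, norm_pow, norm_natCast, norm_polar, abs_of_nonneg h0]
      gcongr
      exact pow_le_one₀ h0 h1.le
    have h4 : 0 ≤ ∑' n : ℕ+, 1 / (n : ℝ) ^ k := (norm_nonneg _).trans h3
    have := one_le_endpointWeight hq
    nlinarith

end Tornheim

/-! ### The double series as an integral over the unit circle -/

namespace Tornheim

open Complex Filter Topology Set

lemma integral_exp_two_pi_int (N : ℤ) :
    ∫ q in (0 : ℝ)..1, exp (2 * Real.pi * I * N * q) = if N = 0 then 1 else 0 := by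
  split_ifs with h
  · simp [h]
  · have hc : 2 * Real.pi * I * N ≠ 0 := by
      simp [Real.pi_ne_zero, h]
    rw [integral_exp_mul_complex hc]
    have : exp (2 * Real.pi * I * N * (1 : ℝ)) = 1 := by
      rw [exp_eq_one_iff]
      exact ⟨N, by push_cast; ring⟩
    rw [this]
    simp

lemma polar_pow (r q : ℝ) (n : ℕ) :
    polar r q ^ n = (r : ℂ) ^ n * exp (2 * Real.pi * I * (n : ℤ) * q) := by
  rw [polar, mul_pow, ← exp_nat_mul]
  congr 2
  push_cast
  ring

lemma polar_one_sub_pow (r q : ℝ) (n : ℕ) :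
    polar r (1 - q) ^ n = (r : ℂ) ^ n * exp (2 * Real.pi * I * (-n : ℤ) * q) := by
  rw [polar, mul_pow, ← exp_nat_mul]
  congr 1
  rw [exp_eq_exp_iff_exists_int]
  exact ⟨n, by push_cast; ring⟩

lemma hasSum_mul_of_summable_norm {α β : Type*} {f : α → ℂ} {g : β → ℂ} {x y : ℂ}
    (hf : HasSum f x) (hg : HasSum g y) (hf' : Summable fun n => ‖f n‖)
    (hg' : Summable fun n => ‖g n‖) : HasSum (fun t : α × β => f t.1 * g t.2) (x * y) :=
  hf.mul hg (summable_mul_of_summable_norm hf' hg')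

lemma hasSum_mul_mul_of_summable_norm {f g h : ℕ+ → ℂ} {x y z : ℂ} (hf : HasSum f x)
    (hg : HasSum g y) (hh : HasSum h z) (hf' : Summable fun n => ‖f n‖)
    (hg' : Summable fun n => ‖g n‖) (hh' : Summable fun n => ‖h n‖) :
    HasSum (fun t : (ℕ+ × ℕ+) × ℕ+ => f t.1.1 * g t.1.2 * h t.2) (x * y * z) :=
  hasSum_mul_of_summable_norm (f := fun t : ℕ+ × ℕ+ => f t.1 * g t.2)
    (hasSum_mul_of_summable_norm hf hg hf' hg') hh (Summable.mul_norm hf' hg') hh'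

/-- Termwise integration of a product of three polylogarithms on a circle of radius `r < 1`. The
third factor is evaluated at an arbitrary `σ q`, which will be `q` or `1 - q`. -/
lemma hasSum_integral_polylog_mul_mul (a b c : ℕ) {r : ℝ} (h0 : 0 ≤ r) (h1 : r < 1) {σ : ℝ → ℝ}
    (hσ : Continuous σ) :
    HasSum (fun t : (ℕ+ × ℕ+) × ℕ+ => ∫ q in (0 : ℝ)..1,
      polar r q ^ (t.1.1 : ℕ) / (t.1.1 : ℂ) ^ a * (polar r q ^ (t.1.2 : ℕ) / (t.1.2 : ℂ) ^ b) *
        (polar r (σ q) ^ (t.2 : ℕ) / (t.2 : ℂ) ^ c))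
      (∫ q in (0 : ℝ)..1, polylog a (polar r q) * polylog b (polar r q) *
        polylog c (polar r (σ q))) := by
  have hn : ∀ q, ‖polar r q‖ < 1 := fun q => by rwa [norm_polar, abs_of_nonneg h0]
  have hle : ∀ (k : ℕ) (q : ℝ) (n : ℕ+), ‖polar r q ^ (n : ℕ) / (n : ℂ) ^ k‖ ≤ r ^ (n : ℕ) :=
    fun k q n => by simpa [norm_polar, abs_of_nonneg h0] using norm_polylog_term_le k (polar r q) n
  have hs := summable_pow_pnat h0 h1
  have hsn : ∀ (k : ℕ) (q : ℝ), Summable fun n : ℕ+ => ‖polar r q ^ (n : ℕ) / (n : ℂ) ^ k‖ :=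
    fun k q => hs.of_nonneg_of_le (fun _ => norm_nonneg _) (hle k q)
  have hpolar := continuous_polar_right r
  have hbound : Summable fun t : (ℕ+ × ℕ+) × ℕ+ =>
      r ^ (t.1.1 : ℕ) * r ^ (t.1.2 : ℕ) * r ^ (t.2 : ℕ) :=
    (hs.mul_of_nonneg hs (fun _ => pow_nonneg h0 _) (fun _ => pow_nonneg h0 _)).mul_of_nonneg hs
      (fun _ => mul_nonneg (pow_nonneg h0 _) (pow_nonneg h0 _)) (fun _ => pow_nonneg h0 _)
  refine intervalIntegral.hasSum_integral_of_dominated_convergence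
    (fun t _ => r ^ (t.1.1 : ℕ) * r ^ (t.1.2 : ℕ) * r ^ (t.2 : ℕ)) (fun t => ?_)
    (fun t => ?_) ?_ ?_ ?_
  · exact Continuous.aestronglyMeasurable (by fun_prop)
  · refine Eventually.of_forall fun q _ => ?_
    rw [norm_mul, norm_mul]
    gcongr
    · exact hle a q _
    · exact hle b q _
    · exact hle c _ _
  · exact Eventually.of_forall fun q _ => hbound
  · exact intervalIntegrable_const
  · refine Eventually.of_forall fun q _ => ?_
    have h := hasSum_mul_mul_of_summable_norm (hasSum_polylog a (hn q)) (hasSum_polylog b (hn q))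
      (hasSum_polylog c (hn (σ q))) (hsn a q) (hsn b q) (hsn c (σ q))
    exact h

/-- All frequencies `n + m + l` in the product are positive. -/
lemma integral_polylog_mul_mul_eq_zero (a b c : ℕ) {r : ℝ} (h0 : 0 ≤ r) (h1 : r < 1) :
    ∫ q in (0 : ℝ)..1, polylog a (polar r q) * polylog b (polar r q) * polylog c (polar r q) =
      0 := by
  refine (hasSum_integral_polylog_mul_mul a b c h0 h1 continuous_id).unique ?_
  convert! hasSum_zero using 1
  funext t
  have e : ∀ q : ℝ, polar r q ^ (t.1.1 : ℕ) / (t.1.1 : ℂ) ^ a *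
      (polar r q ^ (t.1.2 : ℕ) / (t.1.2 : ℂ) ^ b) * (polar r (id q) ^ (t.2 : ℕ) / (t.2 : ℂ) ^ c) =
      (r ^ (t.1.1 : ℕ) * r ^ (t.1.2 : ℕ) * r ^ (t.2 : ℕ) /
        ((t.1.1 : ℂ) ^ a * (t.1.2 : ℂ) ^ b * (t.2 : ℂ) ^ c)) *
        exp (2 * Real.pi * I * ((t.1.1 + t.1.2 + t.2 : ℕ) : ℤ) * q) := by
    intro q
    have e1 : exp (2 * Real.pi * I * ((t.1.1 + t.1.2 + t.2 : ℕ) : ℤ) * q) =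
        exp (2 * Real.pi * I * ((t.1.1 : ℕ) : ℤ) * q) *
        exp (2 * Real.pi * I * ((t.1.2 : ℕ) : ℤ) * q) *
        exp (2 * Real.pi * I * ((t.2 : ℕ) : ℤ) * q) := by
      rw [← exp_add, ← exp_add]; congr 1; push_cast; ring
    rw [id, polar_pow, polar_pow, polar_pow, e1, div_mul_div_comm, div_mul_div_comm]
    ring
  simp_rw [e]
  rw [intervalIntegral.integral_const_mul, integral_exp_two_pi_int, if_neg, mul_zero]
  have := t.2.pos
  omega

lemma term_natCast (a b c : ℕ) (n m : ℕ+) :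
    term a b c n m = 1 / ((n : ℂ) ^ a * (m : ℂ) ^ b * ((n : ℂ) + (m : ℂ)) ^ c) := by
  simp only [term, cpow_natCast]

lemma integral_polylog_mul_mul_one_sub (a b c : ℕ) {r : ℝ} (h0 : 0 ≤ r) (h1 : r < 1) :
    ∫ q in (0 : ℝ)..1, polylog a (polar r q) * polylog b (polar r q) *
      polylog c (polar r (1 - q)) =
      ∑' x : ℕ+ × ℕ+, (r : ℂ) ^ (2 * (x.1 + x.2 : ℕ)) * term a b c x.1 x.2 := by
  have hS := hasSum_integral_polylog_mul_mul a b c h0 h1 (σ := fun q => 1 - q) (by fun_prop)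
  have e : ∀ t : (ℕ+ × ℕ+) × ℕ+, ∫ q in (0 : ℝ)..1, polar r q ^ (t.1.1 : ℕ) / (t.1.1 : ℂ) ^ a *
      (polar r q ^ (t.1.2 : ℕ) / (t.1.2 : ℂ) ^ b) *
        (polar r (1 - q) ^ (t.2 : ℕ) / (t.2 : ℂ) ^ c) =
      (r ^ (t.1.1 : ℕ) * r ^ (t.1.2 : ℕ) * r ^ (t.2 : ℕ) /
        ((t.1.1 : ℂ) ^ a * (t.1.2 : ℂ) ^ b * (t.2 : ℂ) ^ c)) *
        if ((t.1.1 + t.1.2 : ℕ) : ℤ) - (t.2 : ℕ) = 0 then 1 else 0 := by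
    intro t
    rw [← integral_exp_two_pi_int, ← intervalIntegral.integral_const_mul]
    congr 1
    funext q
    have e1 : exp (2 * Real.pi * I * (((t.1.1 + t.1.2 : ℕ) : ℤ) - (t.2 : ℕ) : ℤ) * q) =
        exp (2 * Real.pi * I * ((t.1.1 : ℕ) : ℤ) * q) *
        exp (2 * Real.pi * I * ((t.1.2 : ℕ) : ℤ) * q) *
        exp (2 * Real.pi * I * (-(t.2 : ℕ) : ℤ) * q) := by
      rw [← exp_add, ← exp_add]; congr 1; push_cast; ring
    rw [polar_pow, polar_pow, polar_one_sub_pow, e1, div_mul_div_comm, div_mul_div_comm]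
    ring
  simp_rw [e] at hS
  -- only the terms with third index `n + m` survive
  have hinj : Function.Injective fun x : ℕ+ × ℕ+ => (x, x.1 + x.2) := fun x y h =>
    (Prod.mk.inj h).1
  rw [← hinj.hasSum_iff] at hS
  · rw [← hS.tsum_eq]
    refine tsum_congr fun x => ?_
    simp only [Function.comp_apply, term_natCast]
    rw [if_pos (by simp)]
    push_cast
    rw [← pow_add, ← pow_add, two_mul]
    ring
  · intro t ht
    rw [if_neg, mul_zero]
    intro h
    refine ht ⟨t.1, Prod.ext rfl (PNat.coe_injective ?_)⟩
    have : ((t.1.1 + t.1.2 : ℕ) : ℤ) = (t.2 : ℕ) := by linarith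
    rw [PNat.add_coe]
    exact_mod_cast this

lemma summable_term {a b c : ℕ} (ha : 0 < a) (hb : 0 < b) (hc : 0 < c) :
    Summable fun x : ℕ+ × ℕ+ => term a b c x.1 x.2 := by
  have hs : Summable fun n : ℕ+ => (n : ℝ) ^ (-(3 / 2) : ℝ) :=
    (Real.summable_nat_rpow.mpr (by norm_num : -(3 / 2 : ℝ) < -1)).comp_injective PNat.coe_injective
  have hss := hs.mul_of_nonneg hs (fun _ => by positivity) (fun _ => by positivity)
  refine hss.of_norm_bounded fun x => ?_
  obtain ⟨n, m⟩ := x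
  have hn : (1 : ℝ) ≤ n := by exact_mod_cast n.pos
  have hm : (1 : ℝ) ≤ m := by exact_mod_cast m.pos
  have hn0 : (0 : ℝ) < n := by linarith
  have hm0 : (0 : ℝ) < m := by linarith
  have hnorm : ‖term a b c n m‖ = 1 / ((n : ℝ) ^ a * (m : ℝ) ^ b * ((n : ℝ) + m) ^ c) := by
    rw [term_natCast, norm_div, norm_one, norm_mul, norm_mul, norm_pow, norm_pow, norm_pow,
      norm_natCast, norm_natCast]
    congr 3
    have : (n : ℂ) + m = ((n + m : ℕ) : ℂ) := by push_cast; rfl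
    rw [this, norm_natCast]
    push_cast
    rfl
  have hpow : ∀ x : ℝ, 0 < x → x ^ (-(3 / 2) : ℝ) = 1 / (x * √x) := fun x hx => by
    rw [Real.rpow_neg hx.le, Real.sqrt_eq_rpow, one_div]
    congr 1
    conv_rhs => rw [← Real.rpow_one_add' hx.le (by norm_num)]
    norm_num
  simp only
  rw [hnorm, hpow n hn0, hpow m hm0, one_div_mul_one_div]
  have h1 : (n : ℝ) ≤ (n : ℝ) ^ a := le_self_pow₀ hn ha.ne'
  have h2 : (m : ℝ) ≤ (m : ℝ) ^ b := le_self_pow₀ hm hb.ne'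
  have h3 : (n : ℝ) + m ≤ ((n : ℝ) + m) ^ c := le_self_pow₀ (by linarith) hc.ne'
  -- the arithmetic-geometric mean inequality
  have h4 : √(n : ℝ) * √(m : ℝ) ≤ n + m := by
    nlinarith [sq_nonneg (√(n : ℝ) - √(m : ℝ)), Real.sq_sqrt hn0.le, Real.sq_sqrt hm0.le]
  refine one_div_le_one_div_of_le (by positivity) ?_
  calc (n : ℝ) * √n * (m * √m) = n * m * (√n * √m) := by ring
    _ ≤ (n : ℝ) ^ a * (m : ℝ) ^ b * ((n : ℝ) + m) ^ c := by
      gcongr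
      exact h4.trans h3

lemma T_eq_tsum_prod {a b c : ℕ} (ha : 0 < a) (hb : 0 < b) (hc : 0 < c) :
    T a b c = ∑' x : ℕ+ × ℕ+, term a b c x.1 x.2 :=
  (summable_term ha hb hc).tsum_prod.symm

lemma T_comm {a b c : ℕ} (ha : 0 < a) (hb : 0 < b) (hc : 0 < c) : T a b c = T b a c := by
  rw [T_eq_tsum_prod ha hb hc, T_eq_tsum_prod hb ha hc, ← (Equiv.prodComm ℕ+ ℕ+).tsum_eq]
  refine tsum_congr fun x => ?_
  simp only [Equiv.prodComm_apply, Prod.fst_swap, Prod.snd_swap, term]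
  rw [mul_comm ((x.2 : ℂ) ^ _), add_comm (x.2 : ℂ)]

/-- Passage to the boundary of the unit disc under the integral. -/
lemma tendsto_integral_polylog_mul_mul {a b c : ℕ} (ha : 0 < a) (hb : 0 < b) (hc : 0 < c)
    {σ : ℝ → ℝ} (hσ : Continuous σ) (hσ' : MapsTo σ (Ioo 0 1) (Ioo 0 1))
    (hw : ∀ q, endpointWeight (σ q) = endpointWeight q) :
    Tendsto (fun r => ∫ q in (0 : ℝ)..1, polylog a (polar r q) * polylog b (polar r q) *
      polylog c (polar r (σ q))) (𝓝[<] 1)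
      (𝓝 (∫ q in (0 : ℝ)..1, boundaryPolylog a q * boundaryPolylog b q *
        boundaryPolylog c (σ q))) := by
  obtain ⟨K, hK⟩ := exists_norm_polylog_polar_le ha
  obtain ⟨L, hL⟩ := exists_norm_polylog_polar_le hb
  obtain ⟨M, hM⟩ := exists_norm_polylog_polar_le hc
  have hIoo : ∀ᵐ q : ℝ, q ∈ uIoc (0 : ℝ) 1 → q ∈ Ioo (0 : ℝ) 1 := by
    filter_upwards [Measure.ae_ne volume (1 : ℝ)] with q hq hq'
    rw [uIoc_of_le zero_le_one] at hq'
    exact ⟨hq'.1, lt_of_le_of_ne hq'.2 hq⟩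
  refine intervalIntegral.tendsto_integral_filter_of_dominated_convergence
    (fun q => K * L * M * endpointWeight q ^ 3) ?_ ?_
    (intervalIntegrable_endpointWeight_pow_three.const_mul _) ?_
  · filter_upwards [eventually_nonneg_and_lt_one] with r hr
    exact (((continuous_polylog_polar a hr.1 hr.2).mul (continuous_polylog_polar b hr.1 hr.2)).mul
      ((continuous_polylog_polar c hr.1 hr.2).comp hσ)).aestronglyMeasurable
  · filter_upwards [eventually_nonneg_and_lt_one] with r hr
    filter_upwards [hIoo] with q hq hq'
    have hq := hq hq'
    have h1 := hK r hr.1 hr.2 q hq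
    have h2 := hL r hr.1 hr.2 q hq
    have h3 := hM r hr.1 hr.2 _ (hσ' hq)
    rw [hw] at h3
    have h4 := (norm_nonneg _).trans h1
    have h5 := (norm_nonneg _).trans h2
    rw [norm_mul, norm_mul]
    calc _ ≤ (K * endpointWeight q) * (L * endpointWeight q) * (M * endpointWeight q) := by
          gcongr
      _ = _ := by ring
  · filter_upwards [hIoo] with q hq hq'
    have hq := hq hq'
    exact ((tendsto_polylog_polar ha hq).mul (tendsto_polylog_polar hb hq)).mul
      (tendsto_polylog_polar hc (hσ' hq))

lemma integral_boundaryPolylog_eq_zero {a b c : ℕ} (ha : 0 < a) (hb : 0 < b) (hc : 0 < c) :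
    ∫ q in (0 : ℝ)..1, boundaryPolylog a q * boundaryPolylog b q * boundaryPolylog c q = 0 := by
  refine tendsto_nhds_unique (tendsto_integral_polylog_mul_mul ha hb hc continuous_id
    (fun _ h => h) (fun _ => rfl)) (tendsto_const_nhds.congr' ?_)
  filter_upwards [eventually_nonneg_and_lt_one] with r hr
  exact (integral_polylog_mul_mul_eq_zero a b c hr.1 hr.2).symm

/-- On the unit circle `1 - q` gives the complex conjugate point, so that the integral picks out
the terms in which the third index is the sum of the other two. -/
lemma T_eq_integral_boundaryPolylog {a b c : ℕ} (ha : 0 < a) (hb : 0 < b) (hc : 0 < c) :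
    T a b c = ∫ q in (0 : ℝ)..1,
      boundaryPolylog a q * boundaryPolylog b q * boundaryPolylog c (1 - q) := by
  refine tendsto_nhds_unique ?_ (tendsto_integral_polylog_mul_mul ha hb hc
    (σ := fun q => 1 - q) (by fun_prop) (fun q hq => ⟨by linarith [hq.2], by linarith [hq.1]⟩)
    endpointWeight_one_sub)
  rw [T_eq_tsum_prod ha hb hc]
  have h : Tendsto (fun r : ℝ => ∑' x : ℕ+ × ℕ+,
      (r : ℂ) ^ (2 * (x.1 + x.2 : ℕ)) * term a b c x.1 x.2) (𝓝[<] 1)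
      (𝓝 (∑' x : ℕ+ × ℕ+, term a b c x.1 x.2)) := by
    refine tendsto_tsum_of_dominated_convergence (summable_term ha hb hc).norm (fun x => ?_) ?_
    · have h2 : Continuous fun r : ℝ => (r : ℂ) ^ (2 * (x.1 + x.2 : ℕ)) * term a b c x.1 x.2 := by
        fun_prop
      have h3 := (h2.tendsto 1).mono_left (nhdsWithin_le_nhds (s := Iio 1))
      simpa using h3
    · filter_upwards [eventually_nonneg_and_lt_one] with r hr x
      rw [norm_mul, norm_pow, norm_real, Real.norm_of_nonneg hr.1]
      exact mul_le_of_le_one_left (norm_nonneg _) (pow_le_one₀ hr.1 hr.2.le)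
  refine h.congr' ?_
  filter_upwards [eventually_nonneg_and_lt_one] with r hr
  exact (integral_polylog_mul_mul_one_sub a b c hr.1 hr.2).symm

end Tornheim

/-! ### Trilinear integrals and parity -/

namespace Tornheim

open Complex Set

/-- The trilinear form `∫₀¹ f g h`. -/
noncomputable def tripleIntegral (f g h : ℝ → ℂ) : ℂ := ∫ q in (0 : ℝ)..1, f q * g q * h q

/-- The reflection `f(1 - q)` of a function on `(0, 1)`. -/
def reflect (f : ℝ → ℂ) : ℝ → ℂ := fun q => f (1 - q)

lemma reflect_reflect (f : ℝ → ℂ) : reflect (reflect f) = f := by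
  funext q
  simp [reflect]

lemma MildAtEndpoints.reflect {f : ℝ → ℂ} (hf : MildAtEndpoints f) :
    MildAtEndpoints (reflect f) := hf.comp_one_sub

lemma tripleIntegral_swap (f g h : ℝ → ℂ) : tripleIntegral f g h = tripleIntegral g f h := by
  unfold tripleIntegral
  congr 1; funext q; ring

lemma tripleIntegral_rotate (f g h : ℝ → ℂ) : tripleIntegral f g h = tripleIntegral g h f := by
  unfold tripleIntegral
  congr 1; funext q; ring

lemma tripleIntegral_smul (s t u : ℂ) (f g h : ℝ → ℂ) :
    tripleIntegral (s • f) (t • g) (u • h) = s * t * u * tripleIntegral f g h := by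
  unfold tripleIntegral
  rw [← intervalIntegral.integral_const_mul]
  congr 1; funext q
  simp only [Pi.smul_apply, smul_eq_mul]
  ring

lemma tripleIntegral_reflect (f g h : ℝ → ℂ) :
    tripleIntegral (reflect f) (reflect g) (reflect h) = tripleIntegral f g h := by
  have := intervalIntegral.integral_comp_sub_left (fun q => f q * g q * h q) (a := 0) (b := 1) 1
  simpa [tripleIntegral, reflect] using this

section Trilinear

variable {f f' g g' h h' : ℝ → ℂ}

lemma tripleIntegral_add_smul_left (hf : MildAtEndpoints f) (hf' : MildAtEndpoints f')
    (hg : MildAtEndpoints g) (hh : MildAtEndpoints h) (s : ℂ) :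
    tripleIntegral (f + s • f') g h = tripleIntegral f g h + s * tripleIntegral f' g h := by
  unfold tripleIntegral
  rw [← intervalIntegral.integral_const_mul, ← intervalIntegral.integral_add
    (hf.intervalIntegrable_mul_mul hg hh) ((hf'.intervalIntegrable_mul_mul hg hh).const_mul s)]
  congr 1; funext q
  simp only [Pi.add_apply, Pi.smul_apply, smul_eq_mul]
  ring

lemma tripleIntegral_add_smul₂ (hf : MildAtEndpoints f) (hf' : MildAtEndpoints f')
    (hg : MildAtEndpoints g) (hg' : MildAtEndpoints g') (hh : MildAtEndpoints h) (s t : ℂ) :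
    tripleIntegral (f + s • f') (g + t • g') h = tripleIntegral f g h +
      t * tripleIntegral f g' h + s * tripleIntegral f' g h + s * t * tripleIntegral f' g' h := by
  rw [tripleIntegral_add_smul_left hf hf' (hg.add (hg'.const_smul t)) hh, tripleIntegral_swap f,
    tripleIntegral_swap f', tripleIntegral_add_smul_left hg hg' hf hh,
    tripleIntegral_add_smul_left hg hg' hf' hh, tripleIntegral_swap g, tripleIntegral_swap g',
    tripleIntegral_swap g, tripleIntegral_swap g']
  ring

lemma tripleIntegral_add_smul₃ (hf : MildAtEndpoints f) (hf' : MildAtEndpoints f')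
    (hg : MildAtEndpoints g) (hg' : MildAtEndpoints g') (hh : MildAtEndpoints h)
    (hh' : MildAtEndpoints h') (s t u : ℂ) :
    tripleIntegral (f + s • f') (g + t • g') (h + u • h') =
      tripleIntegral f g h + u * tripleIntegral f g h' + t * tripleIntegral f g' h +
      t * u * tripleIntegral f g' h' + s * tripleIntegral f' g h +
      s * u * tripleIntegral f' g h' + s * t * tripleIntegral f' g' h +
      s * t * u * tripleIntegral f' g' h' := by
  rw [tripleIntegral_add_smul₂ hf hf' hg hg' (hh.add (hh'.const_smul u))]
  have e : ∀ {x y : ℝ → ℂ}, MildAtEndpoints x → MildAtEndpoints y →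
      tripleIntegral x y (h + u • h') = tripleIntegral x y h + u * tripleIntegral x y h' := by
    intro x y hx hy
    rw [← tripleIntegral_rotate, tripleIntegral_add_smul_left hh hh' hx hy,
      tripleIntegral_rotate h, tripleIntegral_rotate h']
  rw [e hf hg, e hf hg', e hf' hg, e hf' hg']
  ring

lemma tripleIntegral_eq_zero_of_reflect {s t u : ℂ} (hf : reflect f = s • f)
    (hg : reflect g = t • g) (hh : reflect h = u • h) (hstu : s * t * u = -1) :
    tripleIntegral f g h = 0 := by
  have h1 := tripleIntegral_reflect f g h
  rw [hf, hg, hh, tripleIntegral_smul, hstu] at h1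
  linear_combination (-1 / 2 : ℂ) * h1

/-- If `g` and `h` have a parity, then `∫ f(1 - q) g h` is a multiple of `∫ f g h`. -/
lemma tripleIntegral_add_reflect₁ (hf : MildAtEndpoints f) (hg : MildAtEndpoints g)
    (hh : MildAtEndpoints h) (s : ℂ) {t u : ℂ} (hgt : reflect g = t • g) (hhu : reflect h = u • h) :
    tripleIntegral (f + s • reflect f) g h = (1 + s * t * u) * tripleIntegral f g h := by
  have h1 := tripleIntegral_smul 1 t u f g h
  rw [← hgt, ← hhu, one_smul, ← tripleIntegral_reflect, reflect_reflect, reflect_reflect] at h1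
  rw [tripleIntegral_add_smul_left hf hf.reflect hg hh, h1]
  ring

lemma tripleIntegral_add_reflect₂ (hf : MildAtEndpoints f) (hg : MildAtEndpoints g)
    (hh : MildAtEndpoints h) (s t : ℂ) {u : ℂ} (hhu : reflect h = u • h) :
    tripleIntegral (f + s • reflect f) (g + t • reflect g) h =
      (1 + s * t * u) * tripleIntegral f g h + (t + s * u) * tripleIntegral f (reflect g) h := by
  have h1 := tripleIntegral_smul 1 1 u f g h
  rw [← hhu, one_smul, one_smul, ← tripleIntegral_reflect, reflect_reflect] at h1
  have h2 := tripleIntegral_smul 1 1 u f (reflect g) h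
  rw [← hhu, one_smul, one_smul, ← tripleIntegral_reflect, reflect_reflect, reflect_reflect] at h2
  rw [tripleIntegral_add_smul₂ hf hf.reflect hg hg.reflect hh, h1, h2]
  ring

lemma tripleIntegral_add_reflect₃ (hf : MildAtEndpoints f) (hg : MildAtEndpoints g)
    (hh : MildAtEndpoints h) (s t u : ℂ) :
    tripleIntegral (f + s • reflect f) (g + t • reflect g) (h + u • reflect h) =
      (1 + s * t * u) * tripleIntegral f g h + (u + s * t) * tripleIntegral f g (reflect h) +
      (t + s * u) * tripleIntegral h f (reflect g) +
      (s + t * u) * tripleIntegral h g (reflect f) := by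
  have h1 := tripleIntegral_reflect f (reflect g) h
  have h2 := tripleIntegral_reflect (reflect f) g h
  have h3 := tripleIntegral_reflect f g (reflect h)
  have h4 := tripleIntegral_reflect f g h
  rw [reflect_reflect] at h1 h2 h3
  rw [tripleIntegral_add_smul₃ hf hf.reflect hg hg.reflect hh hh.reflect, h1, h2, h3, h4,
    tripleIntegral_rotate h f, tripleIntegral_rotate h g, tripleIntegral_swap g,
    tripleIntegral_rotate f (reflect g), tripleIntegral_swap (reflect g)]
  ring

end Trilinear

/-- The part of `A_k` of parity `(-1)^(k+1)` under `q ↦ 1 - q`, a Clausen function up to a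
constant factor. -/
noncomputable def oddPart (k : ℕ) : ℝ → ℂ := A k + (-(-1) ^ k : ℂ) • reflect (A k)

lemma reflect_B (k : ℕ) : reflect (B k) = ((-1) ^ k : ℂ) • B k := by
  funext q
  simp [reflect, B, bernoulliFun_eval_one_sub]

lemma reflect_oddPart (k : ℕ) : reflect (oddPart k) = (-(-1) ^ k : ℂ) • oddPart k := by
  funext q
  have h : ((-1 : ℂ) ^ k) * (-1) ^ k = 1 := by rw [← mul_pow]; simp
  simp only [reflect, oddPart, Pi.add_apply, Pi.smul_apply, smul_eq_mul, sub_sub_cancel]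
  linear_combination (-A k (1 - q)) * h

lemma mildAtEndpoints_oddPart {k : ℕ} (hk : 0 < k) : MildAtEndpoints (oddPart k) :=
  (mildAtEndpoints_A hk).add ((mildAtEndpoints_A hk).reflect.const_smul _)

/-- The ratio of `boundaryPolylog k` to `B_k + (i/π) oddPart_k`. -/
noncomputable def fourierConst (k : ℕ) : ℂ := -(2 * Real.pi * I) ^ k / (2 * k.factorial)

lemma boundaryPolylog_eq (k : ℕ) :
    boundaryPolylog k = fourierConst k • (B k + (I / Real.pi) • oddPart k) := by
  funext q
  simp only [boundaryPolylog, fourierConst, oddPart, reflect, Pi.add_apply, Pi.smul_apply,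
    smul_eq_mul]
  ring

lemma reflect_boundaryPolylog (k : ℕ) : reflect (boundaryPolylog k) =
    ((-1) ^ k * fourierConst k) • (B k + (-(I / Real.pi)) • oddPart k) := by
  have h1 := congrFun (reflect_B k)
  have h2 := congrFun (reflect_oddPart k)
  funext q
  specialize h1 q
  specialize h2 q
  simp only [reflect, boundaryPolylog_eq, Pi.add_apply, Pi.smul_apply, smul_eq_mul] at h1 h2 ⊢
  rw [h1, h2]
  ring

lemma fourierConst_mul_mul (a b c : ℕ) : fourierConst a * fourierConst b * fourierConst c =
    -I ^ (a + b + c) * ((2 * Real.pi : ℂ) ^ (a + b + c) /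
      (2 * a.factorial * b.factorial * c.factorial)) / 4 := by
  have ha : (a.factorial : ℂ) ≠ 0 := by exact_mod_cast a.factorial_ne_zero
  have hb : (b.factorial : ℂ) ≠ 0 := by exact_mod_cast b.factorial_ne_zero
  have hc : (c.factorial : ℂ) ≠ 0 := by exact_mod_cast c.factorial_ne_zero
  unfold fourierConst
  rw [mul_pow _ I a, mul_pow _ I b, mul_pow _ I c, pow_add, pow_add, pow_add, pow_add]
  field_simp
  ring

lemma fourierConst_mul_mul_of_even {a b c : ℕ} (h : Even (a + b + c)) :
    fourierConst a * fourierConst b * fourierConst c = -prefactor a b c / 4 := by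
  have hI : I ^ (a + b + c) = p (a + b + c) := by
    rw [p, if_pos h]
    obtain ⟨m, hm⟩ := h
    rw [hm, ← two_mul, pow_mul, I_sq, Nat.mul_div_cancel_left _ two_pos]
  rw [fourierConst_mul_mul, hI, prefactor]
  ring

lemma fourierConst_mul_mul_of_odd {a b c : ℕ} (h : Odd (a + b + c)) :
    fourierConst a * fourierConst b * fourierConst c * I = -prefactor a b c / 4 := by
  have hI : I ^ (a + b + c) * I = p (a + b + c) := by
    rw [p, if_neg (Nat.not_even_iff_odd.mpr h), ← pow_succ]
    obtain ⟨m, hm⟩ := h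
    rw [hm, show 2 * m + 1 + 1 = 2 * (m + 1) by ring, pow_mul, I_sq,
      Nat.mul_div_cancel_left _ two_pos]
  rw [fourierConst_mul_mul, prefactor]
  linear_combination (-(2 * Real.pi : ℂ) ^ (a + b + c) /
      (2 * a.factorial * b.factorial * c.factorial) / 4) * hI

lemma prefactor_ne_zero (a b c : ℕ) : prefactor a b c ≠ 0 := by
  have ha : (a.factorial : ℂ) ≠ 0 := by exact_mod_cast a.factorial_ne_zero
  have hb : (b.factorial : ℂ) ≠ 0 := by exact_mod_cast b.factorial_ne_zero
  have hc : (c.factorial : ℂ) ≠ 0 := by exact_mod_cast c.factorial_ne_zero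
  have hp : p (a + b + c) ≠ 0 := by
    unfold p
    split_ifs <;> exact pow_ne_zero _ (by norm_num)
  have hpi : (Real.pi : ℂ) ≠ 0 := by exact_mod_cast Real.pi_ne_zero
  exact mul_ne_zero hp (div_ne_zero (pow_ne_zero _ (mul_ne_zero two_ne_zero hpi))
    (mul_ne_zero (mul_ne_zero (mul_ne_zero two_ne_zero ha) hb) hc))

section Products

variable {a b c : ℕ}

lemma tripleIntegral_boundary_eq_zero (ha : 0 < a) (hb : 0 < b) (hc : 0 < c) :
    tripleIntegral (B a + (I / Real.pi) • oddPart a) (B b + (I / Real.pi) • oddPart b)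
      (B c + (I / Real.pi) • oddPart c) = 0 := by
  have h : tripleIntegral (boundaryPolylog a) (boundaryPolylog b) (boundaryPolylog c) = 0 :=
    integral_boundaryPolylog_eq_zero ha hb hc
  have hne : ∀ k, fourierConst k ≠ 0 := fun k =>
    div_ne_zero (neg_ne_zero.mpr (pow_ne_zero _ (by simp [Real.pi_ne_zero])))
      (mul_ne_zero two_ne_zero (by exact_mod_cast k.factorial_ne_zero))
  rw [boundaryPolylog_eq, boundaryPolylog_eq, boundaryPolylog_eq, tripleIntegral_smul] at h
  exact (mul_eq_zero.mp h).resolve_left (mul_ne_zero (mul_ne_zero (hne a) (hne b)) (hne c))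

lemma T_eq_tripleIntegral (ha : 0 < a) (hb : 0 < b) (hc : 0 < c) :
    T a b c = (-1) ^ c * (fourierConst a * fourierConst b * fourierConst c) *
      tripleIntegral (B a + (I / Real.pi) • oddPart a) (B b + (I / Real.pi) • oddPart b)
      (B c + (-(I / Real.pi)) • oddPart c) := by
  have h : T a b c =
      tripleIntegral (boundaryPolylog a) (boundaryPolylog b) (reflect (boundaryPolylog c)) :=
    T_eq_integral_boundaryPolylog ha hb hc
  rw [h, reflect_boundaryPolylog, boundaryPolylog_eq, boundaryPolylog_eq, tripleIntegral_smul]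
  ring

lemma I_div_pi_sq : (I / Real.pi : ℂ) * (I / Real.pi) = -(1 / (Real.pi : ℂ) ^ 2) := by
  have : (I / Real.pi : ℂ) * (I / Real.pi) = I ^ 2 / (Real.pi : ℂ) ^ 2 := by ring
  rw [this, I_sq]
  ring

/-- For even weight, the integrals with an odd number of factors `oddPart` vanish by symmetry. The
first relation comes from the integral for `T`, the second from the vanishing integral. -/
lemma T_of_even_weight (ha : 0 < a) (hb : 0 < b) (hc : 0 < c) (h : Even (a + b + c)) :
    T a b c = (-1) ^ c * (-prefactor a b c / 4) * (tripleIntegral (B a) (B b) (B c) -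
      1 / (Real.pi : ℂ) ^ 2 * (tripleIntegral (oddPart a) (oddPart b) (B c) -
        tripleIntegral (oddPart a) (B b) (oddPart c) -
        tripleIntegral (B a) (oddPart b) (oddPart c))) ∧
    tripleIntegral (B a) (B b) (B c) =
      1 / (Real.pi : ℂ) ^ 2 * (tripleIntegral (oddPart a) (oddPart b) (B c) +
        tripleIntegral (oddPart a) (B b) (oddPart c) +
        tripleIntegral (B a) (oddPart b) (oddPart c)) := by
  have hm := mildAtEndpoints_B
  have hA := mildAtEndpoints_oddPart ha
  have hB := mildAtEndpoints_oddPart hb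
  have hC := mildAtEndpoints_oddPart hc
  have hsign : (-1 : ℂ) ^ a * (-1) ^ b * (-1) ^ c = 1 := by
    rw [← pow_add, ← pow_add, h.neg_one_pow]
  have z1 := tripleIntegral_eq_zero_of_reflect (reflect_oddPart a) (reflect_B b) (reflect_B c)
    (by linear_combination -hsign)
  have z2 := tripleIntegral_eq_zero_of_reflect (reflect_B a) (reflect_oddPart b) (reflect_B c)
    (by linear_combination -hsign)
  have z3 := tripleIntegral_eq_zero_of_reflect (reflect_B a) (reflect_B b) (reflect_oddPart c)
    (by linear_combination -hsign)
  have z4 := tripleIntegral_eq_zero_of_reflect (reflect_oddPart a) (reflect_oddPart b)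
    (reflect_oddPart c) (by linear_combination -hsign)
  have h0 := tripleIntegral_boundary_eq_zero ha hb hc
  rw [tripleIntegral_add_smul₃ (hm a) hA (hm b) hB (hm c) hC, z1, z2, z3, z4] at h0
  have hT := T_eq_tripleIntegral ha hb hc
  rw [tripleIntegral_add_smul₃ (hm a) hA (hm b) hB (hm c) hC, z1, z2, z3, z4,
    fourierConst_mul_mul_of_even h] at hT
  have hI := I_div_pi_sq
  constructor
  · rw [hT]
    linear_combination (-1) ^ c * (-prefactor a b c / 4) *
      (tripleIntegral (oddPart a) (oddPart b) (B c) -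
        tripleIntegral (oddPart a) (B b) (oddPart c) -
        tripleIntegral (B a) (oddPart b) (oddPart c)) * hI
  · linear_combination h0 - (tripleIntegral (oddPart a) (oddPart b) (B c) +
        tripleIntegral (oddPart a) (B b) (oddPart c) +
        tripleIntegral (B a) (oddPart b) (oddPart c)) * hI

/-- For odd weight, the integrals with an even number of factors `oddPart` vanish by symmetry. The
first relation comes from the integral for `T`, the second from the vanishing integral. -/
lemma T_of_odd_weight (ha : 0 < a) (hb : 0 < b) (hc : 0 < c) (h : Odd (a + b + c)) :
    T a b c = (-1) ^ c * (-prefactor a b c / 4) * (1 / (Real.pi : ℂ)) *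
      (tripleIntegral (B a) (oddPart b) (B c) + tripleIntegral (oddPart a) (B b) (B c) -
        tripleIntegral (B a) (B b) (oddPart c) +
        1 / (Real.pi : ℂ) ^ 2 * tripleIntegral (oddPart a) (oddPart b) (oddPart c)) ∧
    tripleIntegral (B a) (oddPart b) (B c) + tripleIntegral (oddPart a) (B b) (B c) +
      tripleIntegral (B a) (B b) (oddPart c) =
      1 / (Real.pi : ℂ) ^ 2 * tripleIntegral (oddPart a) (oddPart b) (oddPart c) := by
  have hm := mildAtEndpoints_B
  have hA := mildAtEndpoints_oddPart ha
  have hB := mildAtEndpoints_oddPart hb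
  have hC := mildAtEndpoints_oddPart hc
  have hsign : (-1 : ℂ) ^ a * (-1) ^ b * (-1) ^ c = -1 := by
    rw [← pow_add, ← pow_add, h.neg_one_pow]
  have z1 := tripleIntegral_eq_zero_of_reflect (reflect_B a) (reflect_B b) (reflect_B c) hsign
  have z2 := tripleIntegral_eq_zero_of_reflect (reflect_oddPart a) (reflect_oddPart b)
    (reflect_B c) (by linear_combination hsign)
  have z3 := tripleIntegral_eq_zero_of_reflect (reflect_oddPart a) (reflect_B b)
    (reflect_oddPart c) (by linear_combination hsign)
  have z4 := tripleIntegral_eq_zero_of_reflect (reflect_B a) (reflect_oddPart b)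
    (reflect_oddPart c) (by linear_combination hsign)
  have h0 := tripleIntegral_boundary_eq_zero ha hb hc
  rw [tripleIntegral_add_smul₃ (hm a) hA (hm b) hB (hm c) hC, z1, z2, z3, z4] at h0
  have hT := T_eq_tripleIntegral ha hb hc
  rw [tripleIntegral_add_smul₃ (hm a) hA (hm b) hB (hm c) hC, z1, z2, z3, z4] at hT
  have hI := I_div_pi_sq
  have hF := fourierConst_mul_mul_of_odd h
  constructor
  · rw [hT, ← hF]
    linear_combination (-1) ^ c * (fourierConst a * fourierConst b * fourierConst c) *
      (-(I / Real.pi)) * tripleIntegral (oddPart a) (oddPart b) (oddPart c) * hI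
  · have hι : (I / Real.pi : ℂ) ≠ 0 := div_ne_zero I_ne_zero (by exact_mod_cast Real.pi_ne_zero)
    apply mul_left_cancel₀ hι
    linear_combination h0 -
      (I / Real.pi) * tripleIntegral (oddPart a) (oddPart b) (oddPart c) * hI

end Products

end Tornheim

/-! ### The parity classes -/

namespace Tornheim

section ParityClasses

variable {a b c : ℕ}

/-- The case of `a`, `b` of the same parity, with sign `ε = (-1)^a = (-1)^b`, and even `c`. -/
lemma T_of_neg_one_pow_eq_of_even (ha : 0 < a) (hb : 0 < b) (hc : 0 < c) {ε : ℂ}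
    (hε : ε * ε = 1) (hεa : (-1 : ℂ) ^ a = ε) (hεb : (-1 : ℂ) ^ b = ε) (hc2 : Even c)
    (hw : Even (a + b + c)) :
    T a b c = (-(1 / 2) * R₁ a b c + R₃ a b c - ε * R₄ a b c) * prefactor a b c := by
  obtain ⟨h1, h2⟩ := T_of_even_weight ha hb hc hw
  have e1 : R₁ a b c = tripleIntegral (B a) (B b) (B c) := rfl
  have e2 : R₃ a b c = 1 / (Real.pi : ℂ) ^ 2 * tripleIntegral (A a) (A b) (B c) := rfl
  have e3 : R₄ a b c = 1 / (Real.pi : ℂ) ^ 2 * tripleIntegral (A a) (reflect (A b)) (B c) := rfl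
  have hJ := tripleIntegral_add_reflect₂ (mildAtEndpoints_A ha) (mildAtEndpoints_A hb)
    (mildAtEndpoints_B c) (-(-1) ^ a) (-(-1) ^ b) (reflect_B c)
  rw [← oddPart, ← oddPart, hεa, hεb, hc2.neg_one_pow] at hJ
  rw [hc2.neg_one_pow] at h1
  rw [e1, e2, e3]
  linear_combination h1 + prefactor a b c / 4 * h2 +
    prefactor a b c / 2 * (1 / (Real.pi : ℂ) ^ 2) * hJ + prefactor a b c / 2 *
      (1 / (Real.pi : ℂ) ^ 2) * tripleIntegral (A a) (A b) (B c) * hε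

/-- The case of `a`, `b` of the same parity, with sign `ε = (-1)^a = (-1)^b`, and odd `c`. -/
lemma T_of_neg_one_pow_eq_of_odd (ha : 0 < a) (hb : 0 < b) (hc : 0 < c) {ε : ℂ}
    (hε : ε * ε = 1) (hεa : (-1 : ℂ) ^ a = ε) (hεb : (-1 : ℂ) ^ b = ε) (hc2 : Odd c)
    (hw : Odd (a + b + c)) :
    T a b c = (-R₂ a b c + R₅ a b c + R₆ a b c - ε * R₆ c a b - ε * R₆ c b a) *
      prefactor a b c := by
  obtain ⟨h1, h2⟩ := T_of_odd_weight ha hb hc hw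
  have e1 : R₂ a b c = 1 / (Real.pi : ℂ) * tripleIntegral (A c) (B a) (B b) := by
    rw [tripleIntegral_rotate]; rfl
  have e2 : R₅ a b c = 1 / (Real.pi : ℂ) ^ 3 * tripleIntegral (A a) (A b) (A c) := rfl
  have e3 : ∀ a b c, R₆ a b c =
    1 / (Real.pi : ℂ) ^ 3 * tripleIntegral (A a) (A b) (reflect (A c)) := fun _ _ _ => rfl
  have hJ₃ := tripleIntegral_add_reflect₃ (mildAtEndpoints_A ha) (mildAtEndpoints_A hb)
    (mildAtEndpoints_A hc) (-(-1) ^ a) (-(-1) ^ b) (-(-1) ^ c)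
  have hJ₁ := tripleIntegral_add_reflect₁ (mildAtEndpoints_A hc) (mildAtEndpoints_B a)
    (mildAtEndpoints_B b) (-(-1) ^ c) (reflect_B a) (reflect_B b)
  rw [← oddPart, ← oddPart, ← oddPart, hεa, hεb, hc2.neg_one_pow] at hJ₃
  rw [← oddPart, hεa, hεb, hc2.neg_one_pow, tripleIntegral_rotate] at hJ₁
  rw [hc2.neg_one_pow] at h1
  rw [e1, e2, e3, e3, e3]
  linear_combination h1 + prefactor a b c / 4 * (1 / (Real.pi : ℂ)) * h2 -
    prefactor a b c / 2 * (1 / (Real.pi : ℂ)) * hJ₁ +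
    prefactor a b c / 2 * (1 / (Real.pi : ℂ) ^ 3) * hJ₃ +
    (prefactor a b c / 2 * (1 / (Real.pi : ℂ) ^ 3) * (tripleIntegral (A a) (A b) (A c) +
      tripleIntegral (A a) (A b) (reflect (A c))) -
      prefactor a b c / 2 * (1 / (Real.pi : ℂ)) * tripleIntegral (A c) (B a) (B b)) * hε

lemma T_of_even_odd_even (ha : 0 < a) (hb : 0 < b) (hc : 0 < c) (ha2 : Even a) (hb2 : Odd b)
    (hc2 : Even c) : T a b c = (-R₂ c a b - R₂ c b a) * prefactor a b c := by
  obtain ⟨h1, h2⟩ := T_of_odd_weight ha hb hc ((ha2.add_odd hb2).add_even hc2)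
  have e1 : ∀ a b c, R₂ a b c = 1 / (Real.pi : ℂ) * tripleIntegral (A c) (B a) (B b) :=
    fun a b c => by rw [tripleIntegral_rotate]; rfl
  have hJb := tripleIntegral_add_reflect₁ (mildAtEndpoints_A hb) (mildAtEndpoints_B c)
    (mildAtEndpoints_B a) (-(-1) ^ b) (reflect_B c) (reflect_B a)
  have hJa := tripleIntegral_add_reflect₁ (mildAtEndpoints_A ha) (mildAtEndpoints_B c)
    (mildAtEndpoints_B b) (-(-1) ^ a) (reflect_B c) (reflect_B b)
  rw [← oddPart, ha2.neg_one_pow, hb2.neg_one_pow, hc2.neg_one_pow, ← tripleIntegral_rotate] at hJb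
  rw [← oddPart, ha2.neg_one_pow, hb2.neg_one_pow, hc2.neg_one_pow, tripleIntegral_rotate,
    tripleIntegral_swap, tripleIntegral_rotate, tripleIntegral_rotate] at hJa
  rw [hc2.neg_one_pow] at h1
  rw [e1, e1]
  linear_combination h1 + prefactor a b c / 4 * (1 / (Real.pi : ℂ)) * h2 -
    prefactor a b c / 2 * (1 / (Real.pi : ℂ)) * hJb -
    prefactor a b c / 2 * (1 / (Real.pi : ℂ)) * hJa

lemma T_of_even_odd_odd (ha : 0 < a) (hb : 0 < b) (hc : 0 < c) (ha2 : Even a) (hb2 : Odd b)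
    (hc2 : Odd c) :
    T a b c = (R₃ c a b + R₃ c b a + R₄ a c b + R₄ b c a) * prefactor a b c := by
  obtain ⟨h1, h2⟩ := T_of_even_weight ha hb hc ((ha2.add_odd hb2).add_odd hc2)
  have e3 : ∀ a b c, R₃ a b c = 1 / (Real.pi : ℂ) ^ 2 * tripleIntegral (A b) (A a) (B c) :=
    fun a b c => by rw [tripleIntegral_swap]; rfl
  have e4 : ∀ a b c,
    R₄ a b c = 1 / (Real.pi : ℂ) ^ 2 * tripleIntegral (A a) (reflect (A b)) (B c) :=
    fun _ _ _ => rfl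
  have hJb := tripleIntegral_add_reflect₂ (mildAtEndpoints_A ha) (mildAtEndpoints_A hc)
    (mildAtEndpoints_B b) (-(-1) ^ a) (-(-1) ^ c) (reflect_B b)
  have hJa := tripleIntegral_add_reflect₂ (mildAtEndpoints_A hb) (mildAtEndpoints_A hc)
    (mildAtEndpoints_B a) (-(-1) ^ b) (-(-1) ^ c) (reflect_B a)
  rw [← oddPart, ← oddPart, ha2.neg_one_pow, hb2.neg_one_pow, hc2.neg_one_pow,
    ← tripleIntegral_rotate, tripleIntegral_swap] at hJb
  rw [← oddPart, ← oddPart, ha2.neg_one_pow, hb2.neg_one_pow, hc2.neg_one_pow,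
    ← tripleIntegral_rotate] at hJa
  rw [hc2.neg_one_pow] at h1
  rw [e3, e3, e4, e4]
  linear_combination h1 + prefactor a b c / 4 * h2 +
    prefactor a b c / 2 * (1 / (Real.pi : ℂ) ^ 2) * (hJb + hJa)

end ParityClasses

end Tornheim

theorem mainTheorem2 (n₁ n₂ n₃ : ℕ) (h₁ : 0 < n₁) (h₂ : 0 < n₂) (h₃ : 0 < n₃) :
    -- the double series and the integrals converge absolutely
    Summable (fun x : ℕ+ × ℕ+ => Tornheim.term n₁ n₂ n₃ x.1 x.2) ∧
    IntervalIntegrable (fun q => Tornheim.B n₁ q * Tornheim.B n₂ q * Tornheim.B n₃ q)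
      volume 0 1 ∧
    IntervalIntegrable (fun q => Tornheim.B n₁ q * Tornheim.B n₂ q * Tornheim.A n₃ q)
      volume 0 1 ∧
    IntervalIntegrable (fun q => Tornheim.A n₁ q * Tornheim.A n₂ q * Tornheim.B n₃ q)
      volume 0 1 ∧
    IntervalIntegrable (fun q => Tornheim.A n₁ q * Tornheim.A n₂ (1 - q) * Tornheim.B n₃ q)
      volume 0 1 ∧
    IntervalIntegrable (fun q => Tornheim.A n₁ q * Tornheim.A n₂ q * Tornheim.A n₃ q)
      volume 0 1 ∧
    IntervalIntegrable (fun q => Tornheim.A n₁ q * Tornheim.A n₂ q * Tornheim.A n₃ (1 - q))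
      volume 0 1 ∧
    -- symmetry, which reduces the two remaining parity classes to cases 3 and 4
    Tornheim.T n₁ n₂ n₃ = Tornheim.T n₂ n₁ n₃ ∧
    -- the six cases
    ∃ T_R : ℂ,
      Tornheim.T n₁ n₂ n₃ = Tornheim.prefactor n₁ n₂ n₃ * T_R ∧
      (Even n₁ ∧ Even n₂ ∧ Even n₃ →
        T_R = -(1 / 2) * Tornheim.R₁ n₁ n₂ n₃ + Tornheim.R₃ n₁ n₂ n₃
          - Tornheim.R₄ n₁ n₂ n₃) ∧
      (Even n₁ ∧ Even n₂ ∧ Odd n₃ →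
        T_R = -Tornheim.R₂ n₁ n₂ n₃ + Tornheim.R₅ n₁ n₂ n₃
          + Tornheim.R₆ n₁ n₂ n₃ - Tornheim.R₆ n₃ n₁ n₂ - Tornheim.R₆ n₃ n₂ n₁) ∧
      (Even n₁ ∧ Odd n₂ ∧ Even n₃ →
        T_R = -Tornheim.R₂ n₃ n₁ n₂ - Tornheim.R₂ n₃ n₂ n₁) ∧
      (Even n₁ ∧ Odd n₂ ∧ Odd n₃ →
        T_R = Tornheim.R₃ n₃ n₁ n₂ + Tornheim.R₃ n₃ n₂ n₁
          + Tornheim.R₄ n₁ n₃ n₂ + Tornheim.R₄ n₂ n₃ n₁) ∧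
      (Odd n₁ ∧ Odd n₂ ∧ Even n₃ →
        T_R = -(1 / 2) * Tornheim.R₁ n₁ n₂ n₃ + Tornheim.R₃ n₁ n₂ n₃
          + Tornheim.R₄ n₁ n₂ n₃) ∧
      (Odd n₁ ∧ Odd n₂ ∧ Odd n₃ →
        T_R = -Tornheim.R₂ n₁ n₂ n₃ + Tornheim.R₅ n₁ n₂ n₃
          + Tornheim.R₆ n₁ n₂ n₃ + Tornheim.R₆ n₃ n₁ n₂ + Tornheim.R₆ n₃ n₂ n₁) := by 
  have hA := fun {k : ℕ} (hk : 0 < k) => Tornheim.mildAtEndpoints_A hk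
  have hB := Tornheim.mildAtEndpoints_B
  have hP := Tornheim.prefactor_ne_zero n₁ n₂ n₃
  refine ⟨Tornheim.summable_term h₁ h₂ h₃,
    (hB n₁).intervalIntegrable_mul_mul (hB n₂) (hB n₃),
    (hB n₁).intervalIntegrable_mul_mul (hB n₂) (hA h₃),
    (hA h₁).intervalIntegrable_mul_mul (hA h₂) (hB n₃),
    (hA h₁).intervalIntegrable_mul_mul (hA h₂).reflect (hB n₃),
    (hA h₁).intervalIntegrable_mul_mul (hA h₂) (hA h₃),
    (hA h₁).intervalIntegrable_mul_mul (hA h₂) (hA h₃).reflect,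
    Tornheim.T_comm h₁ h₂ h₃,
    Tornheim.T n₁ n₂ n₃ / Tornheim.prefactor n₁ n₂ n₃, (mul_div_cancel₀ _ hP).symm,
    ?_, ?_, ?_, ?_, ?_, ?_⟩
  all_goals
    rintro ⟨e₁, e₂, e₃⟩
    rw [div_eq_iff hP]
  · rw [Tornheim.T_of_neg_one_pow_eq_of_even h₁ h₂ h₃ (one_mul 1) e₁.neg_one_pow e₂.neg_one_pow
      e₃ ((e₁.add e₂).add e₃)]
    ring
  · rw [Tornheim.T_of_neg_one_pow_eq_of_odd h₁ h₂ h₃ (one_mul 1) e₁.neg_one_pow e₂.neg_one_pow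
      e₃ ((e₁.add e₂).add_odd e₃)]
    ring
  · exact Tornheim.T_of_even_odd_even h₁ h₂ h₃ e₁ e₂ e₃
  · exact Tornheim.T_of_even_odd_odd h₁ h₂ h₃ e₁ e₂ e₃
  · rw [Tornheim.T_of_neg_one_pow_eq_of_even h₁ h₂ h₃ (by norm_num : (-1 : ℂ) * -1 = 1)
      e₁.neg_one_pow e₂.neg_one_pow e₃ ((e₁.add_odd e₂).add e₃)]
    ring
  · rw [Tornheim.T_of_neg_one_pow_eq_of_odd h₁ h₂ h₃ (by norm_num : (-1 : ℂ) * -1 = 1)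
      e₁.neg_one_pow e₂.neg_one_pow e₃ ((e₁.add_odd e₂).add_odd e₃)]
    ring
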